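/- **Theorem 5.1.** Let $d\ge 1$, let $|\cdot|$ be the Euclidean norm and $B(x,r)=\{y\in\mathbb Z^d:|x-y|<r\}$. Let $C_{xy}=C_{yx}\in[0,\infty)$ $(x,y\in\mathbb Z^d)$ be conductances with $C_{xx}=0$, and assume: (A1) there are $c_1,c_2>0$ with $c_1\le\nu_x:=\sum_{y}C_{xy}\le c_2$ for all $x\in\mathbb Z^d$; (A2) there are $M_0\ge 1$ and $\delta>0$ such that for all $x,y\in\mathbb Z^d$ with $|x-y|=1$ there are $N\ge 2$ and $z_1,\dots,z_N\in B(x,M_0)$ with $z_1=x$, $z_N=y$ and $C_{z_iz_{i+1}}\ge\delta$ for $1\le i\le N-1$; (A3) there are a nonincreasing $\varphi:\mathbb N\to[0,\infty)$ and a constant $c'>0$ with $\sum_{i\ge1}i^{d+1}\varphi(i)<\infty$, $\varphi(2i)\le c'\varphi(i)$ for all $i$, and $C_{xy}\le\varphi(\lfloor|x-y|\rfloor)$ for all $x,y\in\mathbb Z^d$. Let $X$ be the Markov chain on $\mathbb Z^d$ with $\mathbb P^x(X_1=y)=C_{xy}/\nu_x$, and suppose that its range is bounded by $K$, that is, $\mathbb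 P^x(X_1=y)=0$ whenever $|x-y|>K$. Then there are constants $c>0$ and $\theta\in(0,1)$ such that for every $x_0\in\mathbb Z^d$, every real $r\ge 4K(\theta^{-1}+1)$, and every nonnegative bounded $h:\mathbb Z^d\to\mathbb R$ that is harmonic on $B(x_0,r)$, i.e. $\sum_{z}h(z)\,\mathbb P^x(X_1=z)=h(x)$ for all $x\in B(x_0,r)$, $$h(x)\le c\,h(y)\qquad\text{for all }x,y\in B(x_0,\theta r).$$ -/

import Mathlib

namespace ConductanceChain

/-- The point `x` of the lattice `ℤ^d`, seen in Euclidean space `ℝ^d`. -/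
noncomputable def latticePoint {d : ℕ} (x : Fin d → ℤ) : EuclideanSpace ℝ (Fin d) :=
  WithLp.toLp 2 (fun i => (x i : ℝ))

/-- The Euclidean distance `|x - y|` of two lattice points. -/
noncomputable def eDist {d : ℕ} (x y : Fin d → ℤ) : ℝ :=
  ‖latticePoint x - latticePoint y‖

/-- The lattice ball `B(x, r) = {y ∈ ℤ^d : |x - y| < r}`. -/
def latticeBall {d : ℕ} (x : Fin d → ℤ) (r : ℝ) : Set (Fin d → ℤ) :=
  {y | eDist x y < r}

/-- A family of conductances on `ℤ^d`: nonnegative and symmetric. Conductances are attached to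
pairs of distinct points, so the diagonal carries none. -/
structure IsConductance {d : ℕ} (C : (Fin d → ℤ) → (Fin d → ℤ) → ℝ) : Prop where
  nonneg : ∀ x y, 0 ≤ C x y
  symm : ∀ x y, C x y = C y x
  diag : ∀ x, C x x = 0

/-- The total conductance `ν_x = ∑_y C_{xy}` at `x`. -/
noncomputable def totalConductance {d : ℕ} (C : (Fin d → ℤ) → (Fin d → ℤ) → ℝ)
    (x : Fin d → ℤ) : ℝ :=
  ∑' y, C x y

/-- The total conductances are finite, bounded, and bounded away from zero. -/
def BoundedTotalConductance {d : ℕ} (C : (Fin d → ℤ) → (Fin d → ℤ) → ℝ) : Prop :=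
  ∃ c₁ c₂ : ℝ, 0 < c₁ ∧ 0 < c₂ ∧
    ∀ x, Summable (fun y => C x y) ∧ c₁ ≤ totalConductance C x ∧ totalConductance C x ≤ c₂

/-- Uniform local irreducibility: nearest neighbours `x`, `y` are joined inside `B(x, M₀)` by a path
`x = z 1, …, z N = y` all of whose steps have conductance at least `δ`. -/
def UniformlyLocallyIrreducible {d : ℕ} (C : (Fin d → ℤ) → (Fin d → ℤ) → ℝ) : Prop :=
  ∃ M₀ δ : ℝ, 1 ≤ M₀ ∧ 0 < δ ∧
    ∀ x y, eDist x y = 1 →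
      ∃ N : ℕ, 2 ≤ N ∧ ∃ z : ℕ → (Fin d → ℤ),
        (∀ i, 1 ≤ i → i ≤ N → z i ∈ latticeBall x M₀) ∧ z 1 = x ∧ z N = y ∧
        ∀ i, 1 ≤ i → i < N → δ ≤ C (z i) (z (i + 1))

/-- Uniform second moment condition. The decreasing function `φ` lives on the integers, so it is
evaluated at the integer part of the distance. -/
def UniformSecondMoment {d : ℕ} (C : (Fin d → ℤ) → (Fin d → ℤ) → ℝ) : Prop :=
  ∃ φ : ℕ → ℝ, (∀ i, 0 ≤ φ i) ∧ Antitone φ ∧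
    Summable (fun i : ℕ => (i : ℝ) ^ (d + 1) * φ i) ∧
    (∃ c : ℝ, 0 < c ∧ ∀ i, φ (2 * i) ≤ c * φ i) ∧
    ∀ x y, C x y ≤ φ ⌊eDist x y⌋₊

/-- The one-step transition probability `ℙ^x(X₁ = y) = C_{xy} / ν_x` of the chain `X`. -/
noncomputable def stepProb {d : ℕ} (C : (Fin d → ℤ) → (Fin d → ℤ) → ℝ)
    (x y : Fin d → ℤ) : ℝ :=
  C x y / totalConductance C x

/-- The chain `X` has range bounded by `K`: it makes no jump longer than `K`. -/
def RangeBoundedBy {d : ℕ} (C : (Fin d → ℤ) → (Fin d → ℤ) → ℝ) (K : ℝ) : Prop :=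
  ∀ x y, K < eDist x y → stepProb C x y = 0

/-- `h` is harmonic on `A` for the chain `X`: `∑_z h(z) ℙ^x(X₁ = z) = h(x)` for all `x ∈ A`. -/
def HarmonicOnSet {d : ℕ} (C : (Fin d → ℤ) → (Fin d → ℤ) → ℝ)
    (h : (Fin d → ℤ) → ℝ) (A : Set (Fin d → ℤ)) : Prop :=
  ∀ x ∈ A, HasSum (fun z => h z * stepProb C x z) (h x)

end ConductanceChain

/-!
The chain has finite range, so harmonicity is a finite linear equation and the argument runs on
lattice cubes for the sup distance; Euclidean balls reappear only in comparing radii.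

Local irreducibility bounds nearest-neighbour increments by the energy `∑ C x y (f x - f y) ^ 2`
(`UniformlyLocallyIrreducible.exists_sq_sub_le`). Hence the Poincaré inequality on boxes
(`poincare_box`) holds for the chain, and tiling the lattice by boxes turns it into a Faber–Krahn
inequality (`IsNetwork.faberKrahn`). Together with the Caccioppoli inequality
(`IsNetwork.energy_mul_le`) this gives De Giorgi's local maximum principle for subharmonic
functions (`IsNetwork.le_add_of_sum_sq_le`). The iteration halves a dyadic scale and ends at scale
one, where a square sum dominates each of its terms.

For positive harmonic `h` the function `-log h` is subharmonic and has bounded scaled energy. If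
`h ≥ m` on a fixed proportion of a cube, the Poincaré inequality therefore bounds the mean square
of `(log m - log h)₊`, and the local maximum principle bounds `h` from below by a multiple of `m` on
the doubled cube (`IsNetwork.exists_expansion`).

The Harnack inequality (`IsNetwork.exists_harnack_cube`) follows by maximising
`(2R - |x - x₀|) ^ β * h x` over the cube of radius `2R`. Around a maximiser `x₁` the function `h`
is at most a multiple of `h x₁` on a cube of size comparable to the distance of `x₁` to the
boundary, so by the local maximum principle `h ≥ h x₁ / 2` on a proportion of that cube. Repeated
expansion of positivity reaches the whole cube and loses a power of the ratio of the two scales; the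
exponent `β` is this power, so the loss is exactly compensated by the weight.
-/

namespace ConductanceChain

variable {d : ℕ}

/-! ### Boxes, cubes and the Poincaré inequality -/

/-- The half-open lattice box `∏ᵢ [aᵢ, aᵢ + L)`. -/
noncomputable def box (a : Fin d → ℤ) (L : ℕ) : Finset (Fin d → ℤ) :=
  Fintype.piFinset fun i => Finset.Ico (a i) (a i + L)

/-- The lattice cube of centre `x` and radius `n`, a closed ball for the sup distance. -/
noncomputable def cube (x : Fin d → ℤ) (n : ℕ) : Finset (Fin d → ℤ) :=
  box (fun i => x i - n) (2 * n + 1)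

theorem mem_box {a x : Fin d → ℤ} {L : ℕ} :
    x ∈ box a L ↔ ∀ i, a i ≤ x i ∧ x i < a i + L := by
  simp [box]

theorem card_box (a : Fin d → ℤ) (L : ℕ) : (box a L).card = L ^ d := by
  simp [box]

theorem mem_cube_iff_abs {x y : Fin d → ℤ} {n : ℕ} :
    y ∈ cube x n ↔ ∀ i, |y i - x i| ≤ n := by
  simp only [cube, mem_box]
  refine forall_congr' fun i => ?_
  rw [abs_le]
  push_cast
  constructor <;> rintro ⟨h1, h2⟩ <;> constructor <;> omega

theorem mem_cube {x y : Fin d → ℤ} {n : ℕ} : y ∈ cube x n ↔ dist y x ≤ n := by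
  rw [mem_cube_iff_abs, dist_pi_le_iff (Nat.cast_nonneg n)]
  refine forall_congr' fun i => ?_
  rw [Int.dist_eq]
  exact_mod_cast Iff.rfl

theorem mem_cube_comm {x y : Fin d → ℤ} {n : ℕ} : y ∈ cube x n ↔ x ∈ cube y n := by
  rw [mem_cube, mem_cube, dist_comm]

theorem card_cube (x : Fin d → ℤ) (n : ℕ) : (cube x n).card = (2 * n + 1) ^ d :=
  card_box _ _

theorem cube_subset_cube {x y : Fin d → ℤ} {m n : ℕ} (h : dist x y + m ≤ n) :
    cube x m ⊆ cube y n := by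
  intro z hz
  rw [mem_cube] at hz ⊢
  linarith [dist_triangle z x y]

theorem cube_mono (x : Fin d → ℤ) {m n : ℕ} (h : m ≤ n) : cube x m ⊆ cube x n :=
  cube_subset_cube (by simpa using h)

theorem self_mem_cube (x : Fin d → ℤ) (n : ℕ) : x ∈ cube x n := by
  simp [mem_cube]

/-- The squared length of the forward nearest-neighbour gradient. -/
def gradSq (f : (Fin d → ℤ) → ℝ) (x : Fin d → ℤ) : ℝ :=
  ∑ i, (f (x + Pi.single i 1) - f x) ^ 2

theorem sq_sub_le_sum_sq_diff (g : ℤ → ℝ) (b : ℤ) (L : ℕ) {s t : ℤ}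
    (hs : s ∈ Finset.Ico b (b + L)) (ht : t ∈ Finset.Ico b (b + L)) :
    (g s - g t) ^ 2 ≤ L * ∑ r ∈ Finset.Ico b (b + L), (g (r + 1) - g r) ^ 2 := by
  wlog hst : s ≤ t generalizing s t
  · have := this ht hs (by omega)
    rwa [show (g s - g t) ^ 2 = (g t - g s) ^ 2 by ring]
  have tel : ∀ t, s ≤ t → g t - g s = ∑ r ∈ Finset.Ico s t, (g (r + 1) - g r) := by
    intro t hst
    induction t, hst using Int.leInduction with
    | base => simp
    | succ t hst ih =>
      rw [show Finset.Ico s (t + 1) = insert t (Finset.Ico s t) by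
        ext; simp only [Finset.mem_Ico, Finset.mem_insert]; omega,
        Finset.sum_insert (by simp), ← ih]
      ring
  rw [Finset.mem_Ico] at hs ht
  have hsub : Finset.Ico s t ⊆ Finset.Ico b (b + L) :=
    Finset.Ico_subset_Ico hs.1 ht.2.le
  have hcard : ((Finset.Ico s t).card : ℝ) ≤ L := by
    have := Finset.card_le_card hsub
    simp only [Int.card_Ico] at this ⊢
    exact_mod_cast (by omega : (t - s).toNat ≤ L)
  calc (g s - g t) ^ 2 = (∑ r ∈ Finset.Ico s t, (g (r + 1) - g r)) ^ 2 := by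
        rw [← tel t hst]; ring
    _ ≤ (Finset.Ico s t).card * ∑ r ∈ Finset.Ico s t, (g (r + 1) - g r) ^ 2 :=
        sq_sum_le_card_mul_sum_sq
    _ ≤ L * ∑ r ∈ Finset.Ico b (b + L), (g (r + 1) - g r) ^ 2 := by
        gcongr

theorem update_mem_box {a x : Fin d → ℤ} {L : ℕ} (hx : x ∈ box a L) (k : Fin d) {r : ℤ}
    (hr : r ∈ Finset.Ico (a k) (a k + L)) : Function.update x k r ∈ box a L := by
  rw [mem_box] at hx ⊢
  intro i
  rcases eq_or_ne i k with rfl | hi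
  · simpa using hr
  · simpa [hi] using hx i

/-- Resampling one coordinate of a point of the box counts every point of the box `L` times. -/
theorem sum_box_update (a : Fin d → ℤ) (L : ℕ) (k : Fin d) (g : (Fin d → ℤ) → ℝ) :
    ∑ x ∈ box a L, ∑ r ∈ Finset.Ico (a k) (a k + L), g (Function.update x k r)
      = L * ∑ z ∈ box a L, g z := by
  have hL : ∑ z ∈ box a L, ∑ _r ∈ Finset.Ico (a k) (a k + L), g z = L * ∑ z ∈ box a L, g z := by
    simp [Finset.mul_sum]
  rw [← hL, ← Finset.sum_product', ← Finset.sum_product']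
  refine Finset.sum_nbij' (fun p => (Function.update p.1 k p.2, p.1 k))
    (fun p => (Function.update p.1 k p.2, p.1 k)) ?_ ?_ ?_ ?_ ?_
  · rintro ⟨x, r⟩ h
    rw [Finset.mem_product] at h ⊢
    exact ⟨update_mem_box h.1 k h.2, by simpa using mem_box.1 h.1 k⟩
  · rintro ⟨x, r⟩ h
    rw [Finset.mem_product] at h ⊢
    exact ⟨update_mem_box h.1 k h.2, by simpa using mem_box.1 h.1 k⟩
  · rintro ⟨x, r⟩ _
    simp
  · rintro ⟨x, r⟩ _
    simp
  · rintro ⟨x, r⟩ _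
    rfl

theorem sum_sq_sub_update_le (f : (Fin d → ℤ) → ℝ) (a : Fin d → ℤ) (L : ℕ) (k : Fin d) :
    ∑ x ∈ box a L, ∑ y ∈ box a L, (f x - f (Function.update x k (y k))) ^ 2
      ≤ L ^ (d + 2) * ∑ z ∈ box a L, (f (z + Pi.single k 1) - f z) ^ 2 := by
  set D : (Fin d → ℤ) → ℝ := fun z => (f (z + Pi.single k 1) - f z) ^ 2 with hD
  have key : ∀ x ∈ box a L, ∀ y ∈ box a L, (f x - f (Function.update x k (y k))) ^ 2
      ≤ L * ∑ r ∈ Finset.Ico (a k) (a k + L), D (Function.update x k r) := by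
    intro x hx y hy
    have h := sq_sub_le_sum_sq_diff (fun r => f (Function.update x k r)) (a k) L
      (s := x k) (t := y k) (by simpa using mem_box.1 hx k) (by simpa using mem_box.1 hy k)
    simp only [Function.update_eq_self] at h
    refine h.trans_eq ?_
    congr 1
    refine Finset.sum_congr rfl fun r _ => ?_
    have : Function.update x k (r + 1) = Function.update x k r + Pi.single k 1 := by
      ext i
      rcases eq_or_ne i k with rfl | hi <;> simp [*]
    rw [hD, this]
  calc _ ≤ ∑ x ∈ box a L, ∑ _y ∈ box a L,
        (L : ℝ) * ∑ r ∈ Finset.Ico (a k) (a k + L), D (Function.update x k r) :=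
        Finset.sum_le_sum fun x hx => Finset.sum_le_sum fun y hy => key x hx y hy
    _ = L ^ d * (L * (L * ∑ z ∈ box a L, D z)) := by
        rw [← sum_box_update a L k D]
        simp only [Finset.sum_const, card_box, nsmul_eq_mul, Finset.mul_sum]
        push_cast
        rfl
    _ = L ^ (d + 2) * ∑ z ∈ box a L, D z := by ring

/-- Exchanging the coordinates in `S` of two points of a box is an involution of pairs. -/
theorem sum_box_piecewise_swap (a : Fin d → ℤ) (L : ℕ) (S : Finset (Fin d))
    (F : (Fin d → ℤ) → (Fin d → ℤ) → ℝ) :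
    ∑ x ∈ box a L, ∑ y ∈ box a L, F (S.piecewise y x) (S.piecewise x y)
      = ∑ x ∈ box a L, ∑ y ∈ box a L, F x y := by
  have hmem : ∀ x y, x ∈ box a L → y ∈ box a L → S.piecewise y x ∈ box a L := by
    intro x y hx hy
    rw [mem_box] at *
    intro i
    by_cases hi : i ∈ S <;> simp [hi, hx i, hy i]
  rw [← Finset.sum_product', ← Finset.sum_product']
  refine Finset.sum_nbij' (fun p => (S.piecewise p.2 p.1, S.piecewise p.1 p.2))
    (fun p => (S.piecewise p.2 p.1, S.piecewise p.1 p.2)) ?_ ?_ ?_ ?_ ?_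
  · rintro ⟨x, y⟩ h
    rw [Finset.mem_product] at h ⊢
    exact ⟨hmem _ _ h.1 h.2, hmem _ _ h.2 h.1⟩
  · rintro ⟨x, y⟩ h
    rw [Finset.mem_product] at h ⊢
    exact ⟨hmem _ _ h.1 h.2, hmem _ _ h.2 h.1⟩
  · rintro ⟨x, y⟩ _
    ext i <;> by_cases hi : i ∈ S <;> simp [hi]
  · rintro ⟨x, y⟩ _
    ext i <;> by_cases hi : i ∈ S <;> simp [hi]
  · rintro ⟨x, y⟩ _
    rfl

theorem sum_sq_sub_piecewise_le (f : (Fin d → ℤ) → ℝ) (a : Fin d → ℤ) (L : ℕ)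
    (S : Finset (Fin d)) :
    ∑ x ∈ box a L, ∑ y ∈ box a L, (f x - f (S.piecewise y x)) ^ 2
      ≤ 2 ^ S.card * L ^ (d + 2) *
        ∑ z ∈ box a L, ∑ i ∈ S, (f (z + Pi.single i 1) - f z) ^ 2 := by
  induction S using Finset.induction_on with
  | empty => simp
  | insert k S hk ih =>
    have h1 : ∑ x ∈ box a L, ∑ y ∈ box a L,
        (f (S.piecewise y x) - f (Function.update (S.piecewise y x) k (y k))) ^ 2
        ≤ L ^ (d + 2) * ∑ z ∈ box a L, (f (z + Pi.single k 1) - f z) ^ 2 := by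
      refine le_trans (le_of_eq ?_) (sum_sq_sub_update_le f a L k)
      rw [← sum_box_piecewise_swap a L S
        (fun x y => (f x - f (Function.update x k (y k))) ^ 2)]
      simp [hk]
    have h0 : 0 ≤ (L : ℝ) ^ (d + 2) * ∑ z ∈ box a L, (f (z + Pi.single k 1) - f z) ^ 2 := by
      positivity
    have hpow : (1 : ℝ) ≤ 2 ^ S.card := one_le_pow₀ (by norm_num)
    calc _ ≤ ∑ x ∈ box a L, ∑ y ∈ box a L, (2 * (f x - f (S.piecewise y x)) ^ 2 +
          2 * (f (S.piecewise y x) - f (Function.update (S.piecewise y x) k (y k))) ^ 2) := by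
          refine Finset.sum_le_sum fun x _ => Finset.sum_le_sum fun y _ => ?_
          rw [Finset.piecewise_insert]
          nlinarith [sq_nonneg ((f x - f (S.piecewise y x)) -
            (f (S.piecewise y x) - f (Function.update (S.piecewise y x) k (y k))))]
      _ ≤ 2 * (2 ^ S.card * L ^ (d + 2) *
            ∑ z ∈ box a L, ∑ i ∈ S, (f (z + Pi.single i 1) - f z) ^ 2) +
          2 * (L ^ (d + 2) * ∑ z ∈ box a L, (f (z + Pi.single k 1) - f z) ^ 2) := by
          simp only [Finset.sum_add_distrib, ← Finset.mul_sum]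
          gcongr
      _ ≤ _ := by
          rw [Finset.card_insert_of_notMem hk]
          simp only [Finset.sum_insert hk, Finset.sum_add_distrib]
          have h2 := mul_le_mul_of_nonneg_right hpow h0
          rw [pow_succ (2 : ℝ)]
          linarith

/-- **Poincaré inequality** on a lattice box, in two-point form. Two points are joined by changing
one coordinate at a time. -/
theorem poincare_box (f : (Fin d → ℤ) → ℝ) (a : Fin d → ℤ) (L : ℕ) :
    ∑ x ∈ box a L, ∑ y ∈ box a L, (f x - f y) ^ 2
      ≤ 2 ^ d * L ^ (d + 2) * ∑ z ∈ box a L, gradSq f z := by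
  simpa [gradSq] using sum_sq_sub_piecewise_le f a L Finset.univ

/-! ### Finite-range networks and the Faber–Krahn inequality -/

/-- The Dirichlet energy of `f` inside the finite set `Ω`; each unordered pair counts twice. -/
def energy (C : (Fin d → ℤ) → (Fin d → ℤ) → ℝ) (Ω : Finset (Fin d → ℤ))
    (f : (Fin d → ℤ) → ℝ) : ℝ :=
  ∑ x ∈ Ω, ∑ y ∈ Ω, C x y * (f x - f y) ^ 2

/-- The quantitative properties of a finite-range conductance family on which the Harnack
inequality rests, stated with the sup distance: the range is at most `K`, the total conductances
are at most `c₂`, and a nearest-neighbour increment is controlled by the energy inside the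
surrounding cube of radius `M`. -/
structure IsNetwork (C : (Fin d → ℤ) → (Fin d → ℤ) → ℝ) (K M : ℕ) (c₂ κ : ℝ) : Prop where
  nonneg : ∀ x y, 0 ≤ C x y
  symm : ∀ x y, C x y = C y x
  range : ∀ x y, C x y ≠ 0 → y ∈ cube x K
  total_le : ∀ x, ∑ y ∈ cube x K, C x y ≤ c₂
  step : ∀ (f : (Fin d → ℤ) → ℝ) (x : Fin d → ℤ) (i : Fin d),
    (f (x + Pi.single i 1) - f x) ^ 2 ≤ κ * energy C (cube x M) f
  range_pos : 1 ≤ K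
  total_pos : 0 < c₂
  step_pos : 0 < κ

/-- `u` is subharmonic at `x`, for the chain of range `K` with conductances `C`. -/
def SubharmonicAt (C : (Fin d → ℤ) → (Fin d → ℤ) → ℝ) (K : ℕ) (u : (Fin d → ℤ) → ℝ)
    (x : Fin d → ℤ) : Prop :=
  ∑ y ∈ cube x K, C x y * (u x - u y) ≤ 0

/-- `h` is harmonic at `x`, for the chain of range `K` with conductances `C`. -/
def HarmonicAt (C : (Fin d → ℤ) → (Fin d → ℤ) → ℝ) (K : ℕ) (h : (Fin d → ℤ) → ℝ)
    (x : Fin d → ℤ) : Prop :=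
  ∑ y ∈ cube x K, C x y * (h x - h y) = 0

theorem sum_le_sum_of_ne_zero_mem {α : Type*} {g : α → ℝ} (hg : ∀ i, 0 ≤ g i)
    {s t : Finset α} (h : ∀ i ∈ s, g i ≠ 0 → i ∈ t) : ∑ i ∈ s, g i ≤ ∑ i ∈ t, g i := by
  classical
  rw [← Finset.sum_filter_ne_zero s]
  refine Finset.sum_le_sum_of_subset_of_nonneg (fun i hi => ?_) fun i _ _ => hg i
  rw [Finset.mem_filter] at hi
  exact h i hi.1 hi.2

theorem sum_sum_cube_le (g : (Fin d → ℤ) → (Fin d → ℤ) → ℝ) (hg : ∀ u v, 0 ≤ g u v) (M : ℕ)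
    (S Ω : Finset (Fin d → ℤ))
    (hΩ : ∀ x ∈ S, ∀ u ∈ cube x M, ∀ v ∈ cube x M, g u v ≠ 0 → u ∈ Ω ∧ v ∈ Ω) :
    ∑ x ∈ S, ∑ u ∈ cube x M, ∑ v ∈ cube x M, g u v
      ≤ (2 * M + 1) ^ d * ∑ u ∈ Ω, ∑ v ∈ Ω, g u v := by
  have h1 : ∀ x ∈ S, ∑ u ∈ cube x M, ∑ v ∈ cube x M, g u v
      ≤ ∑ u ∈ Ω, if u ∈ cube x M then ∑ v ∈ Ω, g u v else 0 := by
    intro x hx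
    have h2 : ∀ u ∈ cube x M, ∑ v ∈ cube x M, g u v
        ≤ if u ∈ Ω then ∑ v ∈ Ω, g u v else 0 := by
      intro u hu
      split_ifs with hu'
      · exact sum_le_sum_of_ne_zero_mem (hg u) fun v hv h => (hΩ x hx u hu v hv h).2
      · refine (Finset.sum_eq_zero fun v hv => ?_).le
        by_contra h
        exact hu' (hΩ x hx u hu v hv h).1
    refine (Finset.sum_le_sum h2).trans_eq ?_
    rw [← Finset.sum_filter, ← Finset.sum_filter]
    refine Finset.sum_congr ?_ fun _ _ => rfl
    ext u
    simp [and_comm]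
  have h3 : ∀ u, (∑ x ∈ S, if u ∈ cube x M then ∑ v ∈ Ω, g u v else 0)
      ≤ (2 * M + 1) ^ d * ∑ v ∈ Ω, g u v := by
    intro u
    rw [← Finset.sum_filter, Finset.sum_const, nsmul_eq_mul]
    have h0 : 0 ≤ ∑ v ∈ Ω, g u v := Finset.sum_nonneg fun v _ => hg u v
    refine mul_le_mul_of_nonneg_right ?_ h0
    have : (S.filter fun x => u ∈ cube x M).card ≤ (cube u M).card := by
      refine Finset.card_le_card fun x hx => ?_
      exact mem_cube_comm.1 (Finset.mem_filter.1 hx).2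
    rw [card_cube] at this
    exact_mod_cast this
  calc _ ≤ _ := Finset.sum_le_sum h1
    _ = ∑ u ∈ Ω, ∑ x ∈ S, if u ∈ cube x M then ∑ v ∈ Ω, g u v else 0 := Finset.sum_comm
    _ ≤ _ := by
      rw [Finset.mul_sum]
      exact Finset.sum_le_sum fun u _ => h3 u

namespace IsNetwork

variable {C : (Fin d → ℤ) → (Fin d → ℤ) → ℝ} {K M : ℕ} {c₂ κ : ℝ}

theorem sum_gradSq_le (hN : IsNetwork C K M c₂ κ) (f : (Fin d → ℤ) → ℝ)
    (S Ω : Finset (Fin d → ℤ))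
    (hΩ : ∀ x ∈ S, ∀ u ∈ cube x M, ∀ v ∈ cube x M, C u v * (f u - f v) ^ 2 ≠ 0 →
      u ∈ Ω ∧ v ∈ Ω) :
    ∑ x ∈ S, gradSq f x ≤ d * κ * (2 * M + 1) ^ d * energy C Ω f := by
  have hκ := hN.step_pos
  have h1 : ∀ x, gradSq f x ≤ d * κ * energy C (cube x M) f := by
    intro x
    refine (Finset.sum_le_sum fun i _ => hN.step f x i).trans_eq ?_
    simp [mul_assoc]
  have h2 := sum_sum_cube_le (fun u v => C u v * (f u - f v) ^ 2)
    (fun u v => mul_nonneg (hN.nonneg u v) (sq_nonneg _)) M S Ω hΩ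
  calc _ ≤ ∑ x ∈ S, d * κ * energy C (cube x M) f := Finset.sum_le_sum fun x _ => h1 x
    _ = d * κ * ∑ x ∈ S, energy C (cube x M) f := by rw [Finset.mul_sum]
    _ ≤ d * κ * ((2 * M + 1) ^ d * energy C Ω f) := by
      refine mul_le_mul_of_nonneg_left h2 (by positivity)
    _ = _ := by ring

end IsNetwork

/-- Poincaré inequality for functions vanishing on a part `Z` of the box. -/
theorem card_mul_sum_sq_le (f : (Fin d → ℤ) → ℝ) (a : Fin d → ℤ) (L : ℕ)
    (Z : Finset (Fin d → ℤ)) (hZ : Z ⊆ box a L) (hf : ∀ z ∈ Z, f z = 0) :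
    Z.card * ∑ x ∈ box a L, f x ^ 2 ≤ 2 ^ d * L ^ (d + 2) * ∑ z ∈ box a L, gradSq f z := by
  refine le_trans ?_ (poincare_box f a L)
  rw [Finset.mul_sum]
  refine Finset.sum_le_sum fun x _ => ?_
  calc (Z.card : ℝ) * f x ^ 2 = ∑ z ∈ Z, (f x - f z) ^ 2 := by
        rw [Finset.sum_congr rfl fun z hz => by rw [hf z hz, sub_zero]]
        simp
    _ ≤ _ := Finset.sum_le_sum_of_subset_of_nonneg hZ fun _ _ _ => sq_nonneg _

theorem mem_tile {L : ℕ} (hL : 0 < L) {q x : Fin d → ℤ} :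
    x ∈ box (fun i => q i * L) L ↔ (fun i => x i / (L : ℤ)) = q := by
  rw [mem_box, funext_iff]
  refine forall_congr' fun i => ?_
  have hL' : (0 : ℤ) < L := by exact_mod_cast hL
  rw [Int.ediv_eq_iff_of_pos hL']

/-- **Faber–Krahn inequality**: a function vanishing off a set of at most `L ^ d / 2` points has
its `ℓ²` norm controlled by `L ^ 2` times its energy. Lattice space is tiled with boxes of side
`L`; the function vanishes on at least half of each tile, where the Poincaré inequality applies. -/
theorem IsNetwork.faberKrahn {C : (Fin d → ℤ) → (Fin d → ℤ) → ℝ} {K M : ℕ} {c₂ κ : ℝ}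
    (hN : IsNetwork C K M c₂ κ) (f : (Fin d → ℤ) → ℝ) (S Ω : Finset (Fin d → ℤ)) (L : ℕ)
    (hL : 0 < L) (hf : ∀ x, f x ≠ 0 → x ∈ S) (hS : 2 * S.card ≤ L ^ d)
    (hΩ : ∀ x ∈ S, cube x K ⊆ Ω) :
    ∑ x ∈ S, f x ^ 2 ≤ 2 ^ (d + 1) * d * κ * (2 * M + 1) ^ d * L ^ 2 * energy C Ω f := by
  classical
  set tile : (Fin d → ℤ) → Finset (Fin d → ℤ) := fun q => box (fun i => q i * L) L with htile
  have hLr : (0 : ℝ) < L := by exact_mod_cast hL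
  have htile_le : ∀ q, ∑ x ∈ tile q, f x ^ 2 ≤ 2 ^ (d + 1) * L ^ 2 * ∑ z ∈ tile q, gradSq f z := by
    intro q
    have h1 := card_mul_sum_sq_le f (fun i => q i * L) L (tile q \ S) Finset.sdiff_subset
      (fun z hz => by_contra fun h => (Finset.mem_sdiff.1 hz).2 (hf z h))
    have h2 : (L : ℝ) ^ d ≤ 2 * (tile q \ S).card := by
      have h3 := Finset.le_card_sdiff S (tile q)
      rw [card_box] at h3
      exact_mod_cast (by omega : L ^ d ≤ 2 * (tile q \ S).card)
    have h4 : 0 ≤ ∑ x ∈ tile q, f x ^ 2 := by positivity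
    have h5 : (L : ℝ) ^ d * ∑ x ∈ tile q, f x ^ 2
        ≤ L ^ d * (2 ^ (d + 1) * L ^ 2 * ∑ z ∈ tile q, gradSq f z) := by
      calc _ ≤ 2 * (tile q \ S).card * ∑ x ∈ tile q, f x ^ 2 := by gcongr
        _ = 2 * ((tile q \ S).card * ∑ x ∈ tile q, f x ^ 2) := by ring
        _ ≤ 2 * (2 ^ d * L ^ (d + 2) * ∑ z ∈ tile q, gradSq f z) := by gcongr
        _ = _ := by ring
    exact le_of_mul_le_mul_left h5 (by positivity)
  set idx : (Fin d → ℤ) → (Fin d → ℤ) := fun x i => x i / (L : ℤ) with hidx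
  have hdisj : (↑(S.image idx) : Set (Fin d → ℤ)).PairwiseDisjoint tile := by
    intro q _ q' _ hqq'
    refine Finset.disjoint_left.2 fun x hx hx' => hqq' ?_
    rw [htile, mem_tile hL] at hx hx'
    exact hx.symm.trans hx'
  have hgrad := hN.sum_gradSq_le f ((S.image idx).biUnion tile) Ω (by
    intro x _ u _ v _ huv
    have hC : C u v ≠ 0 := left_ne_zero_of_mul huv
    have hfuv : f u - f v ≠ 0 := fun h => huv (by simp [h])
    have huv' := hN.range u v hC
    have hvu' := mem_cube_comm.1 huv'
    by_cases hu : f u = 0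
    · have hv : v ∈ S := hf v fun h => hfuv (by rw [hu, h, sub_zero])
      exact ⟨hΩ v hv hvu', hΩ v hv (self_mem_cube v K)⟩
    · exact ⟨hΩ u (hf u hu) (self_mem_cube u K), hΩ u (hf u hu) huv'⟩)
  calc ∑ x ∈ S, f x ^ 2 = ∑ q ∈ S.image idx, ∑ x ∈ S with idx x = q, f x ^ 2 :=
        (Finset.sum_fiberwise_of_maps_to (fun x hx => Finset.mem_image_of_mem _ hx) _).symm
    _ ≤ ∑ q ∈ S.image idx, ∑ x ∈ tile q, f x ^ 2 := by
        refine Finset.sum_le_sum fun q _ =>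
          Finset.sum_le_sum_of_subset_of_nonneg (fun x hx => ?_) fun _ _ _ => sq_nonneg _
        exact (mem_tile hL).2 (Finset.mem_filter.1 hx).2
    _ ≤ ∑ q ∈ S.image idx, 2 ^ (d + 1) * L ^ 2 * ∑ z ∈ tile q, gradSq f z :=
        Finset.sum_le_sum fun q _ => htile_le q
    _ = 2 ^ (d + 1) * L ^ 2 * ∑ z ∈ (S.image idx).biUnion tile, gradSq f z := by
        rw [Finset.sum_biUnion hdisj, Finset.mul_sum]
    _ ≤ 2 ^ (d + 1) * L ^ 2 * (d * κ * (2 * M + 1) ^ d * energy C Ω f) := by gcongr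
    _ = _ := by ring

/-! ### Energy estimates and the local maximum principle -/

/-- The piecewise linear cutoff in the sup distance, equal to `1` within distance `a - s` of `x₀`
and to `0` beyond distance `a`. -/
noncomputable def cutoff (x₀ : Fin d → ℤ) (a s : ℝ) (x : Fin d → ℤ) : ℝ :=
  max 0 (min 1 ((a - dist x x₀) / s))

theorem cutoff_nonneg (x₀ : Fin d → ℤ) (a s : ℝ) (x : Fin d → ℤ) : 0 ≤ cutoff x₀ a s x :=
  le_max_left _ _

theorem cutoff_eq_one {x₀ : Fin d → ℤ} {a s : ℝ} (hs : 0 < s) {x : Fin d → ℤ}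
    (hx : dist x x₀ ≤ a - s) : cutoff x₀ a s x = 1 := by
  have : 1 ≤ (a - dist x x₀) / s := by rw [le_div_iff₀ hs]; linarith
  rw [cutoff, min_eq_left this, max_eq_right zero_le_one]

theorem dist_lt_of_cutoff_ne_zero {x₀ : Fin d → ℤ} {a s : ℝ} (hs : 0 < s) {x : Fin d → ℤ}
    (hx : cutoff x₀ a s x ≠ 0) : dist x x₀ < a := by
  by_contra! h
  refine hx (max_eq_left ((min_le_right _ _).trans ?_))
  exact div_nonpos_of_nonpos_of_nonneg (by linarith) hs.le

theorem abs_cutoff_sub_le (x₀ : Fin d → ℤ) (a : ℝ) {s : ℝ} (hs : 0 < s) (x y : Fin d → ℤ) :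
    |cutoff x₀ a s x - cutoff x₀ a s y| ≤ dist x y / s := by
  calc |cutoff x₀ a s x - cutoff x₀ a s y|
      ≤ |min 1 ((a - dist x x₀) / s) - min 1 ((a - dist y x₀) / s)| := by
        simpa [cutoff, max_comm] using
          abs_max_sub_max_le_abs (min 1 ((a - dist x x₀) / s)) (min 1 ((a - dist y x₀) / s)) 0
    _ ≤ |(a - dist x x₀) / s - (a - dist y x₀) / s| := by
        have := abs_min_sub_min_le_max 1 ((a - dist x x₀) / s) 1 ((a - dist y x₀) / s)
        simpa using this
    _ = |dist y x₀ - dist x x₀| / s := by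
        rw [← sub_div, abs_div, abs_of_pos hs]
        congr 2
        ring
    _ ≤ dist x y / s := by
        gcongr
        rw [dist_comm x y]
        exact abs_dist_sub_le y x x₀

/-- The pointwise inequality behind the energy estimate for `log h`. With `σ² = b / a` the last product equals
`(p - q)² - (pσ - q/σ)²`. -/
theorem min_sq_mul_sq_log_sub_le {a b p q : ℝ} (ha : 0 < a) (hb : 0 < b) (hp : 0 ≤ p)
    (hq : 0 ≤ q) :
    min p q ^ 2 * (Real.log a - Real.log b) ^ 2
      ≤ 16 * (p - q) ^ 2 - 8 * ((a - b) * (p ^ 2 / a - q ^ 2 / b)) := by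
  -- Both sides are symmetric under exchanging `(a, p)` and `(b, q)`.
  wlog hab : a ≤ b generalizing a b p q
  · have := this hb ha hq hp (by linarith)
    rw [min_comm]
    calc _ = min q p ^ 2 * (Real.log b - Real.log a) ^ 2 := by ring
      _ ≤ _ := this
      _ = _ := by ring
  obtain ⟨σ, hσ, hbσ⟩ : ∃ σ : ℝ, 1 ≤ σ ∧ b = a * σ ^ 2 := by
    refine ⟨√(b / a), ?_, ?_⟩
    · rw [Real.one_le_sqrt, le_div_iff₀ ha]
      linarith
    · rw [Real.sq_sqrt (by positivity)]
      field_simp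
  have hσ0 : 0 < σ := by linarith
  set ω := σ - 1 / σ with hω
  have hinv : 1 / σ ≤ 1 := by rw [div_le_one hσ0]; exact hσ
  have hinv0 : 0 < 1 / σ := by positivity
  have hlogσ : Real.log σ ≤ ω := by
    have := Real.log_le_sub_one_of_pos hσ0
    linarith
  have hlog0 : 0 ≤ Real.log σ := Real.log_nonneg hσ
  have hlog : (Real.log a - Real.log b) ^ 2 ≤ 4 * ω ^ 2 := by
    rw [hbσ, Real.log_mul ha.ne' (by positivity), Real.log_pow]
    push_cast
    nlinarith
  have hprod : (a - b) * (p ^ 2 / a - q ^ 2 / b) = (p - q) ^ 2 - (p * σ - q * (1 / σ)) ^ 2 := by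
    rw [hbσ]
    field_simp
    ring
  have hmain : min p q ^ 2 * ω ^ 2 ≤ 2 * (p * σ - q * (1 / σ)) ^ 2 + 2 * (p - q) ^ 2 := by
    have hmin0 : 0 ≤ min p q := le_min hp hq
    have h1 : p * ω = (p * σ - q * (1 / σ)) - (p - q) * (1 / σ) := by rw [hω]; ring
    have h2 : min p q ^ 2 * ω ^ 2 ≤ (p * ω) ^ 2 := by
      rw [mul_pow]
      gcongr
      exact min_le_left _ _
    have h3 : ((p - q) * (1 / σ)) ^ 2 ≤ (p - q) ^ 2 := by
      rw [mul_pow]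
      refine mul_le_of_le_one_right (sq_nonneg _) ?_
      exact pow_le_one₀ hinv0.le hinv
    rw [h1] at h2
    nlinarith [sq_nonneg ((p * σ - q * (1 / σ)) + (p - q) * (1 / σ))]
  rw [hprod]
  calc _ ≤ min p q ^ 2 * (4 * ω ^ 2) := by gcongr
    _ ≤ _ := by linarith

namespace IsNetwork

variable {C : (Fin d → ℤ) → (Fin d → ℤ) → ℝ} {K M : ℕ} {c₂ κ : ℝ}

theorem sum_mul_eq (hN : IsNetwork C K M c₂ κ) {Ω : Finset (Fin d → ℤ)} {x : Fin d → ℤ}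
    (hx : cube x K ⊆ Ω) (g : (Fin d → ℤ) → ℝ) :
    ∑ y ∈ Ω, C x y * g y = ∑ y ∈ cube x K, C x y * g y := by
  refine (Finset.sum_subset hx fun y _ hy => ?_).symm
  rw [by_contra fun h => hy (hN.range x y h), zero_mul]

theorem sum_le (hN : IsNetwork C K M c₂ κ) (Ω : Finset (Fin d → ℤ)) (x : Fin d → ℤ) :
    ∑ y ∈ Ω, C x y ≤ c₂ :=
  (sum_le_sum_of_ne_zero_mem (hN.nonneg x) fun y _ h => hN.range x y h).trans (hN.total_le x)

/-- Summation by parts. -/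
theorem sum_sum_mul_sub (hN : IsNetwork C K M c₂ κ) (Ω : Finset (Fin d → ℤ))
    (w p : (Fin d → ℤ) → ℝ) :
    ∑ x ∈ Ω, ∑ y ∈ Ω, C x y * ((w x - w y) * (p x - p y))
      = 2 * ∑ x ∈ Ω, p x * ∑ y ∈ Ω, C x y * (w x - w y) := by
  have h1 : ∑ x ∈ Ω, ∑ y ∈ Ω, C x y * ((w x - w y) * p x)
      = ∑ x ∈ Ω, p x * ∑ y ∈ Ω, C x y * (w x - w y) := by
    refine Finset.sum_congr rfl fun x _ => ?_
    rw [Finset.mul_sum]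
    exact Finset.sum_congr rfl fun y _ => by ring
  have h2 : ∑ x ∈ Ω, ∑ y ∈ Ω, C x y * ((w x - w y) * p y)
      = - ∑ x ∈ Ω, ∑ y ∈ Ω, C x y * ((w x - w y) * p x) := by
    rw [Finset.sum_comm, ← Finset.sum_neg_distrib]
    refine Finset.sum_congr rfl fun x _ => ?_
    rw [← Finset.sum_neg_distrib]
    refine Finset.sum_congr rfl fun y _ => ?_
    rw [hN.symm y x]
    ring
  calc _ = ∑ x ∈ Ω, ∑ y ∈ Ω, C x y * ((w x - w y) * p x)
        - ∑ x ∈ Ω, ∑ y ∈ Ω, C x y * ((w x - w y) * p y) := by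
        simp only [← Finset.sum_sub_distrib]
        exact Finset.sum_congr rfl fun x _ => Finset.sum_congr rfl fun y _ => by ring
    _ = _ := by rw [h2, h1]; ring

/-- **Caccioppoli inequality**. The difference of the two sides is, up to sign, twice the
Laplacian of `w` tested against `η² w`. -/
theorem energy_mul_le (hN : IsNetwork C K M c₂ κ) (Ω : Finset (Fin d → ℤ))
    (η w : (Fin d → ℤ) → ℝ) (hw : ∀ x, 0 ≤ w x)
    (hsub : ∀ x, η x ≠ 0 → w x ≠ 0 → cube x K ⊆ Ω ∧ SubharmonicAt C K w x) :
    energy C Ω (fun x => η x * w x)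
      ≤ ∑ x ∈ Ω, ∑ y ∈ Ω, C x y * (w x * w y * (η x - η y) ^ 2) := by
  have h1 : energy C Ω (fun x => η x * w x)
      = ∑ x ∈ Ω, ∑ y ∈ Ω, C x y * ((w x - w y) * (η x ^ 2 * w x - η y ^ 2 * w y))
        + ∑ x ∈ Ω, ∑ y ∈ Ω, C x y * (w x * w y * (η x - η y) ^ 2) := by
    simp only [energy, ← Finset.sum_add_distrib]
    exact Finset.sum_congr rfl fun x _ => Finset.sum_congr rfl fun y _ => by ring
  rw [h1, hN.sum_sum_mul_sub Ω w fun x => η x ^ 2 * w x]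
  have h2 : ∑ x ∈ Ω, η x ^ 2 * w x * ∑ y ∈ Ω, C x y * (w x - w y) ≤ 0 := by
    refine Finset.sum_nonpos fun x _ => ?_
    by_cases hη : η x = 0
    · simp [hη]
    by_cases hwx : w x = 0
    · simp [hwx]
    obtain ⟨hΩ, hs⟩ := hsub x hη hwx
    rw [hN.sum_mul_eq hΩ]
    exact mul_nonpos_of_nonneg_of_nonpos (mul_nonneg (sq_nonneg _) (hw x)) hs
  linarith

/-- The right-hand side of the Caccioppoli inequality for a cutoff of slope `1 / s`. -/
theorem sum_mul_cutoff_le (hN : IsNetwork C K M c₂ κ) (Ω : Finset (Fin d → ℤ))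
    (w : (Fin d → ℤ) → ℝ) (x₀ : Fin d → ℤ) (a : ℝ) {s : ℝ} (hs : 0 < s) :
    ∑ x ∈ Ω, ∑ y ∈ Ω, C x y * (w x * w y * (cutoff x₀ a s x - cutoff x₀ a s y) ^ 2)
      ≤ (K / s) ^ 2 * c₂ * ∑ x ∈ Ω, w x ^ 2 := by
  have hpt : ∀ x y, C x y * (w x * w y * (cutoff x₀ a s x - cutoff x₀ a s y) ^ 2)
      ≤ (K / s) ^ 2 / 2 * (C x y * w x ^ 2) + (K / s) ^ 2 / 2 * (C x y * w y ^ 2) := by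
    intro x y
    by_cases hC : C x y = 0
    · simp [hC]
    have hd : dist x y ≤ K := by
      rw [dist_comm]
      exact mem_cube.1 (hN.range x y hC)
    have h1 : |cutoff x₀ a s x - cutoff x₀ a s y| ≤ K / s :=
      (abs_cutoff_sub_le x₀ a hs x y).trans (by gcongr)
    have h2 : (cutoff x₀ a s x - cutoff x₀ a s y) ^ 2 ≤ (K / s) ^ 2 := by
      rw [← sq_abs]
      gcongr
    have h3 : w x * w y ≤ (w x ^ 2 + w y ^ 2) / 2 := by nlinarith [sq_nonneg (w x - w y)]
    have h4 : w x * w y * (cutoff x₀ a s x - cutoff x₀ a s y) ^ 2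
        ≤ (w x ^ 2 + w y ^ 2) / 2 * (K / s) ^ 2 := by gcongr
    have h5 := mul_le_mul_of_nonneg_left h4 (hN.nonneg x y)
    linarith
  have hx : ∀ x, ∑ y ∈ Ω, C x y * w x ^ 2 ≤ c₂ * w x ^ 2 := by
    intro x
    rw [← Finset.sum_mul]
    exact mul_le_mul_of_nonneg_right (hN.sum_le Ω x) (sq_nonneg _)
  have hA : ∑ x ∈ Ω, ∑ y ∈ Ω, C x y * w x ^ 2 ≤ c₂ * ∑ x ∈ Ω, w x ^ 2 := by
    rw [Finset.mul_sum]
    exact Finset.sum_le_sum fun x _ => hx x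
  have hB : ∑ x ∈ Ω, ∑ y ∈ Ω, C x y * w y ^ 2 = ∑ x ∈ Ω, ∑ y ∈ Ω, C x y * w x ^ 2 := by
    rw [Finset.sum_comm]
    exact Finset.sum_congr rfl fun x _ => Finset.sum_congr rfl fun y _ => by rw [hN.symm]
  calc _ ≤ ∑ x ∈ Ω, ∑ y ∈ Ω,
        ((K / s) ^ 2 / 2 * (C x y * w x ^ 2) + (K / s) ^ 2 / 2 * (C x y * w y ^ 2)) :=
        Finset.sum_le_sum fun x _ => Finset.sum_le_sum fun y _ => hpt x y
    _ = (K / s) ^ 2 * ∑ x ∈ Ω, ∑ y ∈ Ω, C x y * w x ^ 2 := by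
        simp only [Finset.sum_add_distrib, ← Finset.mul_sum, hB]
        ring
    _ ≤ (K / s) ^ 2 * (c₂ * ∑ x ∈ Ω, w x ^ 2) := by gcongr
    _ = _ := by ring

/-- Energy estimate for the logarithm of a positive harmonic function, obtained by testing the
equation against `η² / h`. -/
theorem sum_min_sq_mul_sq_log_sub_le (hN : IsNetwork C K M c₂ κ) (Ω : Finset (Fin d → ℤ))
    (η h : (Fin d → ℤ) → ℝ) (hh : ∀ x, 0 < h x) (hη0 : ∀ x, 0 ≤ η x)
    (hη : ∀ x, η x ≠ 0 → cube x K ⊆ Ω ∧ HarmonicAt C K h x) :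
    ∑ x ∈ Ω, ∑ y ∈ Ω, C x y * (min (η x) (η y) ^ 2 * (Real.log (h x) - Real.log (h y)) ^ 2)
      ≤ 16 * ∑ x ∈ Ω, ∑ y ∈ Ω, C x y * (η x - η y) ^ 2 := by
  have h0 : ∑ x ∈ Ω, ∑ y ∈ Ω, C x y * ((h x - h y) * (η x ^ 2 / h x - η y ^ 2 / h y)) = 0 := by
    rw [hN.sum_sum_mul_sub Ω h fun x => η x ^ 2 / h x, Finset.sum_eq_zero, mul_zero]
    intro x _
    by_cases hx : η x = 0
    · simp [hx]
    obtain ⟨hΩ, hs⟩ := hη x hx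
    rw [hN.sum_mul_eq hΩ, hs, mul_zero]
  calc _ ≤ ∑ x ∈ Ω, ∑ y ∈ Ω, (16 * (C x y * (η x - η y) ^ 2)
        - 8 * (C x y * ((h x - h y) * (η x ^ 2 / h x - η y ^ 2 / h y)))) := by
        refine Finset.sum_le_sum fun x _ => Finset.sum_le_sum fun y _ => ?_
        have := mul_le_mul_of_nonneg_left
          (min_sq_mul_sq_log_sub_le (hh x) (hh y) (hη0 x) (hη0 y)) (hN.nonneg x y)
        linarith
    _ = _ := by
        simp only [Finset.sum_sub_distrib, ← Finset.mul_sum, h0]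
        ring

theorem subharmonicAt_posPart (hN : IsNetwork C K M c₂ κ) {u : (Fin d → ℤ) → ℝ} {x : Fin d → ℤ}
    (ℓ : ℝ) (hu : SubharmonicAt C K u x) (hx : max (u x - ℓ) 0 ≠ 0) :
    SubharmonicAt C K (fun y => max (u y - ℓ) 0) x := by
  refine le_trans (Finset.sum_le_sum fun y _ => ?_) hu
  refine mul_le_mul_of_nonneg_left ?_ (hN.nonneg x y)
  have h1 : max (u x - ℓ) 0 = u x - ℓ := by
    rcases max_choice (u x - ℓ) 0 with h | h
    · exact h
    · exact absurd h hx
  have h2 := le_max_left (u y - ℓ) 0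
  simp only [h1]
  linarith

/-- The logarithm of a positive harmonic function is superharmonic, since `log t ≤ t - 1`. -/
theorem subharmonicAt_neg_log (hN : IsNetwork C K M c₂ κ) {h : (Fin d → ℤ) → ℝ} {x : Fin d → ℤ}
    (hh : ∀ y, 0 < h y) (hx : HarmonicAt C K h x) (b : ℝ) :
    SubharmonicAt C K (fun y => b - Real.log (h y)) x := by
  have h1 : ∀ y, C x y * ((b - Real.log (h x)) - (b - Real.log (h y)))
      ≤ - (1 / h x) * (C x y * (h x - h y)) := by
    intro y
    have h2 := Real.log_le_sub_one_of_pos (div_pos (hh y) (hh x))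
    rw [Real.log_div (hh y).ne' (hh x).ne'] at h2
    have h3 := mul_le_mul_of_nonneg_left h2 (hN.nonneg x y)
    have h4 : C x y * (h y / h x - 1) = - (1 / h x) * (C x y * (h x - h y)) := by
      have := (hh x).ne'
      field_simp
      ring
    linarith
  refine (Finset.sum_le_sum fun y _ => h1 y).trans_eq ?_
  rw [← Finset.mul_sum, hx, mul_zero]

/-- **Local maximum principle**, by De Giorgi's iteration. From scale `2 ^ (j + 1)` to scale `2 ^ j`
the level is raised by `a`; the truncation then lives on at most half of `2 ^ ((j + 1) * d)` points,
so the Faber–Krahn and Caccioppoli inequalities reduce its square sum by a factor which is as small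
as required once the gap parameter `t` between successive cubes is large. -/
theorem le_add_of_sum_sq_le (hN : IsNetwork C K M c₂ κ) {t : ℕ} (htK : K ≤ t)
    (ht : 2 ^ (d + 4) * (2 ^ (d + 1) * d * κ * (2 * M + 1) ^ d) * c₂ * (K : ℝ) ^ 2 ≤ (t : ℝ) ^ 2)
    (u : (Fin d → ℤ) → ℝ) (x₀ : Fin d → ℤ) (j n : ℕ) (ℓ a : ℝ) (ha : 0 < a)
    (hsub : ∀ x ∈ cube x₀ (n + 2 * t * 2 ^ j), SubharmonicAt C K u x)
    (hsum : ∑ x ∈ cube x₀ (n + 2 * t * 2 ^ j), max (u x - ℓ) 0 ^ 2 ≤ a ^ 2 / 2 * (2 ^ j) ^ d) :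
    ∀ x ∈ cube x₀ n, u x ≤ ℓ + 2 * a := by
  induction j generalizing ℓ a with
  | zero =>
    intro x hx
    have h1 : max (u x - ℓ) 0 ^ 2 ≤ a ^ 2 / 2 * (2 ^ 0) ^ d :=
      (Finset.single_le_sum (f := fun x => max (u x - ℓ) 0 ^ 2) (fun _ _ => sq_nonneg _)
        (cube_mono x₀ (Nat.le_add_right _ _) hx)).trans hsum
    have h2 : max (u x - ℓ) 0 ≤ a := by
      refine le_of_sq_le_sq ?_ ha.le
      simp only [pow_zero, one_pow, mul_one] at h1
      nlinarith [sq_nonneg a]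
    linarith [le_max_left (u x - ℓ) 0]
  | succ j ih =>
    have ht1 : 1 ≤ t := hN.range_pos.trans htK
    have ht0 : (0 : ℝ) < t := by exact_mod_cast ht1
    have hκ := hN.step_pos
    have hc := hN.total_pos
    set Ω := cube x₀ (n + 2 * t * 2 ^ (j + 1)) with hΩ
    set w : (Fin d → ℤ) → ℝ := fun x => max (u x - (ℓ + a)) 0 with hw
    have hw0 : ∀ x, 0 ≤ w x := fun x => le_max_right _ _
    set s : ℝ := t * 2 ^ j with hs
    have hs0 : 0 < s := by positivity
    set b : ℝ := n + 2 * t * 2 ^ j + s with hb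
    set η := cutoff x₀ b s with hη
    have hηΩ : ∀ x, η x ≠ 0 → cube x K ⊆ Ω := by
      intro x hx
      have h1 := dist_lt_of_cutoff_ne_zero hs0 hx
      refine cube_subset_cube ?_
      have h2 : (K : ℝ) ≤ s := by
        have h3 : (1 : ℝ) ≤ 2 ^ j := one_le_pow₀ (by norm_num)
        have h4 : (K : ℝ) ≤ t := by exact_mod_cast htK
        rw [hs]
        nlinarith
      push_cast
      rw [pow_succ]
      linarith
    set S := Ω.filter fun x => w x ≠ 0 with hS
    have hwle : ∀ x, w x ≤ max (u x - ℓ) 0 := fun x =>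
      max_le_max (by linarith) le_rfl
    have hlarge : ∀ x ∈ S, a ^ 2 ≤ max (u x - ℓ) 0 ^ 2 := by
      intro x hx
      have h1 : w x ≠ 0 := (Finset.mem_filter.1 hx).2
      have h2 : a ≤ u x - ℓ := by
        by_contra! h
        exact h1 (max_eq_right (by linarith))
      have h3 := h2.trans (le_max_left _ 0)
      gcongr
    have hScard : 2 * S.card ≤ (2 ^ (j + 1)) ^ d := by
      have h1 : (S.card : ℝ) * a ^ 2 ≤ a ^ 2 / 2 * (2 ^ (j + 1)) ^ d := by
        refine le_trans ?_ hsum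
        rw [← nsmul_eq_mul]
        refine (Finset.card_nsmul_le_sum S _ _ hlarge).trans ?_
        exact Finset.sum_le_sum_of_subset_of_nonneg (Finset.filter_subset _ _)
          fun _ _ _ => sq_nonneg _
      have h2 : a ^ 2 * (2 * S.card : ℝ) ≤ a ^ 2 * (2 ^ (j + 1)) ^ d := by linarith
      have h3 := le_of_mul_le_mul_left h2 (by positivity)
      exact_mod_cast h3
    have hfS : ∀ x, η x * w x ≠ 0 → x ∈ S := by
      intro x hx
      refine Finset.mem_filter.2 ⟨?_, right_ne_zero_of_mul hx⟩
      exact hηΩ x (left_ne_zero_of_mul hx) (self_mem_cube x K)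
    set S' := S.filter fun x => η x ≠ 0 with hS'
    have hFK := hN.faberKrahn (fun x => η x * w x) S' Ω (2 ^ (j + 1)) (by positivity)
      (fun x hx => Finset.mem_filter.2 ⟨hfS x hx, left_ne_zero_of_mul hx⟩)
      ((Nat.mul_le_mul_left 2 (Finset.card_filter_le _ _)).trans hScard)
      (fun x hx => hηΩ x (Finset.mem_filter.1 hx).2)
    have hCac := (hN.energy_mul_le Ω η w hw0 fun x hx hwx => ⟨hηΩ x hx,
      hN.subharmonicAt_posPart (ℓ + a) (hsub x (hηΩ x hx (self_mem_cube x K))) hwx⟩).trans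
      (hN.sum_mul_cutoff_le Ω w x₀ b hs0)
    have hwsum : ∑ x ∈ Ω, w x ^ 2 ≤ a ^ 2 / 2 * (2 ^ (j + 1)) ^ d := by
      refine (Finset.sum_le_sum fun x _ => ?_).trans hsum
      have := hw0 x
      have := hwle x
      gcongr
    have hinner : ∑ x ∈ cube x₀ (n + 2 * t * 2 ^ j), w x ^ 2
        ≤ ∑ x ∈ S', (η x * w x) ^ 2 := by
      have h1 : ∀ x ∈ cube x₀ (n + 2 * t * 2 ^ j), η x = 1 := by
        intro x hx
        refine cutoff_eq_one hs0 ?_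
        have := mem_cube.1 hx
        push_cast at this
        linarith
      rw [Finset.sum_congr rfl fun x hx =>
        show w x ^ 2 = (η x * w x) ^ 2 by rw [h1 x hx, one_mul]]
      refine sum_le_sum_of_ne_zero_mem (fun x => sq_nonneg _) fun x _ hx => ?_
      have hx' : η x * w x ≠ 0 := fun h => hx (by rw [h]; norm_num)
      exact Finset.mem_filter.2 ⟨hfS x hx', left_ne_zero_of_mul hx'⟩
    have hnew : ∑ x ∈ cube x₀ (n + 2 * t * 2 ^ j), max (u x - (ℓ + a)) 0 ^ 2
        ≤ (a / 2) ^ 2 / 2 * (2 ^ j) ^ d := by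
      set A : ℝ := 2 ^ (d + 1) * d * κ * (2 * M + 1) ^ d with hA
      have hA0 : 0 ≤ A := by positivity
      calc _ ≤ ∑ x ∈ S', (η x * w x) ^ 2 := hinner
        _ ≤ A * ((2 ^ (j + 1) : ℕ) : ℝ) ^ 2 * energy C Ω (fun x => η x * w x) := hFK
        _ ≤ A * ((2 ^ (j + 1) : ℕ) : ℝ) ^ 2 * ((K / s) ^ 2 * c₂ *
            (a ^ 2 / 2 * (2 ^ (j + 1)) ^ d)) := by
            refine mul_le_mul_of_nonneg_left (hCac.trans ?_) (by positivity)
            gcongr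
        _ = (2 ^ (d + 4) * A * c₂ * K ^ 2) / t ^ 2 * ((a / 2) ^ 2 / 2 * (2 ^ j) ^ d) := by
            rw [hs]
            push_cast
            simp only [pow_succ, mul_pow]
            field_simp
        _ ≤ 1 * ((a / 2) ^ 2 / 2 * (2 ^ j) ^ d) := by
            gcongr
            rw [div_le_one (by positivity)]
            exact ht
        _ = _ := one_mul _
    intro x hx
    have hle : n + 2 * t * 2 ^ j ≤ n + 2 * t * 2 ^ (j + 1) := by
      rw [pow_succ]
      nlinarith [Nat.zero_le (2 * t * 2 ^ j)]
    have := ih (ℓ + a) (a / 2) (by positivity)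
      (fun x hx => hsub x (cube_mono x₀ hle hx)) hnew x hx
    linarith

end IsNetwork

/-! ### Expansion of positivity and the Harnack inequality on cubes -/

namespace IsNetwork

variable {C : (Fin d → ℤ) → (Fin d → ℤ) → ℝ} {K M : ℕ} {c₂ κ : ℝ}

/-- The local maximum principle with the gap parameter fixed as a power of two. -/
theorem exists_localMax (hN : IsNetwork C K M c₂ κ) :
    ∃ τ : ℕ, ∀ (u : (Fin d → ℤ) → ℝ) (x₀ : Fin d → ℤ) (j n : ℕ) (ℓ a : ℝ), 0 < a →
      (∀ x ∈ cube x₀ (n + 2 * 2 ^ τ * 2 ^ j), SubharmonicAt C K u x) →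
      ∑ x ∈ cube x₀ (n + 2 * 2 ^ τ * 2 ^ j), max (u x - ℓ) 0 ^ 2 ≤ a ^ 2 / 2 * (2 ^ j) ^ d →
      ∀ x ∈ cube x₀ n, u x ≤ ℓ + 2 * a := by
  set B : ℝ := 2 ^ (d + 4) * (2 ^ (d + 1) * d * κ * (2 * M + 1) ^ d) * c₂ * (K : ℝ) ^ 2 with hB
  have hlt : K + ⌈B⌉₊ < 2 ^ (K + ⌈B⌉₊) := Nat.lt_two_pow_self
  refine ⟨K + ⌈B⌉₊, fun u x₀ j n ℓ a ha hsub hsum =>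
    hN.le_add_of_sum_sq_le (t := 2 ^ (K + ⌈B⌉₊)) (by omega) ?_ u x₀ j n ℓ a ha hsub hsum⟩
  set T := 2 ^ (K + ⌈B⌉₊)
  have h1 : (⌈B⌉₊ : ℝ) ≤ T := by exact_mod_cast (by omega : ⌈B⌉₊ ≤ T)
  have h2 : (1 : ℝ) ≤ T := by exact_mod_cast (by omega : 1 ≤ T)
  calc B ≤ ⌈B⌉₊ := Nat.le_ceil B
    _ ≤ T := h1
    _ ≤ (T : ℝ) ^ 2 := by nlinarith

/-- Energy bound for the truncated logarithm of a positive harmonic function on a cube. When `n` and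
`R` are comparable to `P`, it is of order `P ^ (d - 2)`, as for a fixed function scaled by `P`. -/
theorem energy_log_le (hN : IsNetwork C K M c₂ κ) {h : (Fin d → ℤ) → ℝ} (hh : ∀ x, 0 < h x)
    (x₁ : Fin d → ℤ) (n P R : ℕ) (hP : 1 ≤ P) (hR : n + 2 * K * P ≤ R)
    (hharm : ∀ x ∈ cube x₁ R, HarmonicAt C K h x) (b : ℝ) :
    energy C (cube x₁ n) (fun x => max (b - Real.log (h x)) 0)
      ≤ 16 * ((1 / P) ^ 2 * c₂ * (2 * R + 1) ^ d) := by
  have hK : 1 ≤ K := hN.range_pos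
  have hK0 : (0 : ℝ) < K := by exact_mod_cast hK
  have hP0 : (0 : ℝ) < P := by exact_mod_cast hP
  have hRr : (n : ℝ) + 2 * K * P ≤ R := by exact_mod_cast hR
  set s : ℝ := K * P with hs
  have hs0 : 0 < s := by positivity
  set η := cutoff x₁ (n + s) s with hη
  set Ω := cube x₁ R with hΩ
  have hηΩ : ∀ x, η x ≠ 0 → cube x K ⊆ Ω := by
    intro x hx
    have h1 := dist_lt_of_cutoff_ne_zero hs0 hx
    refine cube_subset_cube ?_
    have h2 : (K : ℝ) ≤ s := by
      have : (1 : ℝ) ≤ P := by exact_mod_cast hP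
      rw [hs]
      nlinarith
    linarith
  have hη1 : ∀ x ∈ cube x₁ n, η x = 1 := fun x hx =>
    cutoff_eq_one hs0 (by simpa using mem_cube.1 hx)
  have hsubset : cube x₁ n ⊆ Ω :=
    cube_mono x₁ (le_trans (Nat.le_add_right _ _) hR)
  have hterm : ∀ x y, 0 ≤ C x y *
      (min (η x) (η y) ^ 2 * (Real.log (h x) - Real.log (h y)) ^ 2) := fun x y =>
    mul_nonneg (hN.nonneg x y) (by positivity)
  calc _ ≤ ∑ x ∈ cube x₁ n, ∑ y ∈ cube x₁ n, C x y *
        (min (η x) (η y) ^ 2 * (Real.log (h x) - Real.log (h y)) ^ 2) := by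
        refine Finset.sum_le_sum fun x hx => Finset.sum_le_sum fun y hy => ?_
        refine mul_le_mul_of_nonneg_left ?_ (hN.nonneg x y)
        rw [hη1 x hx, hη1 y hy, min_self, one_pow, one_mul, sq_le_sq]
        refine (abs_max_sub_max_le_abs _ _ 0).trans_eq ?_
        rw [← abs_neg]
        congr 1
        ring
    _ ≤ ∑ x ∈ Ω, ∑ y ∈ Ω, C x y *
        (min (η x) (η y) ^ 2 * (Real.log (h x) - Real.log (h y)) ^ 2) := by
        refine (Finset.sum_le_sum fun x _ =>
          Finset.sum_le_sum_of_subset_of_nonneg hsubset fun y _ _ => hterm x y).trans ?_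
        exact Finset.sum_le_sum_of_subset_of_nonneg hsubset fun x _ _ =>
          Finset.sum_nonneg fun y _ => hterm x y
    _ ≤ 16 * ∑ x ∈ Ω, ∑ y ∈ Ω, C x y * (η x - η y) ^ 2 :=
        hN.sum_min_sq_mul_sq_log_sub_le Ω η h hh (cutoff_nonneg _ _ _) fun x hx =>
          ⟨hηΩ x hx, hharm x (hηΩ x hx (self_mem_cube x K))⟩
    _ ≤ 16 * ((K / s) ^ 2 * c₂ * ∑ x ∈ Ω, (1 : ℝ) ^ 2) := by
        have := hN.sum_mul_cutoff_le Ω (fun _ => 1) x₁ (n + s) hs0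
        simp only [one_mul] at this
        gcongr
    _ = _ := by
        have h1 : (K : ℝ) / s = 1 / P := by
          rw [hs]
          field_simp
        rw [h1, one_pow, Finset.sum_const, hΩ, card_cube]
        simp

/-- **Expansion of positivity**: if a positive harmonic function is at least `m` on a fixed
proportion of a cube, then it is at least a constant times `m` on the cube of twice the size. The
truncated logarithm `(log m - log h)₊` is subharmonic and vanishes where `h ≥ m`, so the Poincaré
inequality and the energy estimate for `log h` bound its mean square, and the local maximum
principle bounds its supremum. -/
theorem exists_expansion (hN : IsNetwork C K M c₂ κ) :
    ∃ Λ : ℕ, ∀ ε : ℝ, 0 < ε → ∃ c : ℝ, 0 < c ∧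
      ∀ (h : (Fin d → ℤ) → ℝ) (x₁ : Fin d → ℤ) (j : ℕ) (m : ℝ), (∀ x, 0 < h x) → 0 < m →
        (∀ x ∈ cube x₁ (Λ * 2 ^ j), HarmonicAt C K h x) →
        ε * (2 ^ j) ^ d ≤ ((cube x₁ (2 ^ j)).filter fun z => m ≤ h z).card →
        ∀ y ∈ cube x₁ (2 * 2 ^ j), c * m ≤ h y := by
  obtain ⟨τ, hτ⟩ := hN.exists_localMax
  have hκ := hN.step_pos
  have hc := hN.total_pos
  set T := 2 ^ τ with hT
  set Λ : ℕ := 2 + 2 * T + M + 2 * K with hΛ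
  set B : ℝ := 2 * Λ + 1 with hB
  set Q : ℝ := 2 ^ d * B ^ (2 * d + 2) * (d * κ * (2 * M + 1) ^ d) * (16 * c₂) with hQ
  have hQ0 : 0 ≤ Q := by positivity
  refine ⟨Λ, fun ε hε => ?_⟩
  set a : ℝ := 2 * Q / ε + 1 with ha
  have ha1 : 1 ≤ a := by
    have : 0 ≤ 2 * Q / ε := by positivity
    linarith
  refine ⟨Real.exp (-(2 * a)), Real.exp_pos _, fun h x₁ j m hh hm hharm hcard y hy => ?_⟩
  set P : ℕ := 2 ^ j with hP
  have hP1 : 1 ≤ P := Nat.one_le_two_pow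
  have hP1r : (1 : ℝ) ≤ P := by exact_mod_cast hP1
  have hP0 : (0 : ℝ) < P := by linarith
  set N : ℕ := 2 * P + 2 * T * P with hNdef
  have hNM : N + M + 2 * K * P ≤ Λ * P := by
    have : M ≤ M * P := Nat.le_mul_of_pos_right M hP1
    rw [hNdef, hΛ]
    nlinarith
  have hLB : ((2 * N + 1 : ℕ) : ℝ) ≤ B * P := by
    have h1 : N ≤ Λ * P := by
      have := Nat.zero_le (2 * K * P)
      omega
    have h2 : (N : ℝ) ≤ Λ * P := by exact_mod_cast h1
    push_cast
    rw [hB]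
    linarith
  set v : (Fin d → ℤ) → ℝ := fun x => max (Real.log m - Real.log (h x)) 0 with hv
  set Z := (cube x₁ P).filter fun z => m ≤ h z with hZ
  have hZsub : Z ⊆ box (fun i => x₁ i - N) (2 * N + 1) := by
    refine (Finset.filter_subset _ _).trans (cube_mono x₁ ?_)
    rw [hNdef]
    have := Nat.zero_le (2 * T * P)
    omega
  have hpoin := card_mul_sum_sq_le v (fun i => x₁ i - N) (2 * N + 1) Z hZsub (by
    intro z hz
    refine max_eq_right ?_
    have := Real.log_le_log hm (Finset.mem_filter.1 hz).2
    linarith)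
  have hgrad := hN.sum_gradSq_le v (cube x₁ N) (cube x₁ (N + M)) (by
    intro x hx u hu w hw _
    have hsub : cube x M ⊆ cube x₁ (N + M) := by
      refine cube_subset_cube ?_
      push_cast
      linarith [mem_cube.1 hx]
    exact ⟨hsub hu, hsub hw⟩)
  have hen := hN.energy_log_le hh x₁ (N + M) P (Λ * P) hP1 hNM hharm (Real.log m)
  have hRB : (2 * ((Λ * P : ℕ) : ℝ) + 1) ≤ B * P := by
    push_cast
    rw [hB]
    linarith
  have hV0 : 0 ≤ ∑ x ∈ cube x₁ N, v x ^ 2 := by positivity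
  have hB0 : 0 < B := by positivity
  have hsum : ε * (P : ℝ) ^ d * ∑ x ∈ cube x₁ N, v x ^ 2 ≤ Q * (P : ℝ) ^ d * (P : ℝ) ^ d := by
    calc _ ≤ (Z.card : ℝ) * ∑ x ∈ cube x₁ N, v x ^ 2 := by
          refine mul_le_mul_of_nonneg_right ?_ hV0
          rw [hP]
          push_cast
          exact hcard
      _ ≤ 2 ^ d * ((2 * N + 1 : ℕ) : ℝ) ^ (d + 2) * ∑ z ∈ cube x₁ N, gradSq v z := hpoin
      _ ≤ 2 ^ d * (B * P) ^ (d + 2) *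
          (d * κ * (2 * M + 1) ^ d * (16 * ((1 / P) ^ 2 * c₂ * (B * P) ^ d))) := by
          refine mul_le_mul (by gcongr) (hgrad.trans ?_)
            (Finset.sum_nonneg fun z _ => Finset.sum_nonneg fun _ _ => sq_nonneg _) (by positivity)
          refine mul_le_mul_of_nonneg_left (hen.trans ?_) (by positivity)
          gcongr
      _ = Q * (P : ℝ) ^ d * (P : ℝ) ^ d := by
          rw [hQ]
          simp only [mul_pow, pow_add, pow_mul, div_pow, one_pow]
          field_simp
          rw [← pow_mul, ← pow_mul, mul_comm d 2, mul_comm]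
  have hsum' : ∑ x ∈ cube x₁ N, v x ^ 2 ≤ a ^ 2 / 2 * (P : ℝ) ^ d := by
    have h1 : (ε * (P : ℝ) ^ d) * ∑ x ∈ cube x₁ N, v x ^ 2
        ≤ (ε * (P : ℝ) ^ d) * (Q / ε * (P : ℝ) ^ d) := by
      refine hsum.trans_eq ?_
      field_simp
    have h2 := le_of_mul_le_mul_left h1 (by positivity)
    refine h2.trans ?_
    have h3 : Q / ε ≤ a ^ 2 / 2 := by
      have : 2 * (Q / ε) + 1 = a := by rw [ha]; ring
      nlinarith
    gcongr
  have hmax := hτ (fun x => Real.log m - Real.log (h x)) x₁ j (2 * P) 0 a (by linarith)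
    (fun x hx => hN.subharmonicAt_neg_log hh (hharm x (cube_mono x₁ ?_ hx)) _)
    (by simpa [hP] using hsum') y hy
  · have h1 : m ≤ h y * Real.exp (2 * a) := by
      have h2 : Real.log m ≤ Real.log (h y) + 2 * a := by linarith
      rw [← Real.exp_le_exp, Real.exp_add, Real.exp_log hm, Real.exp_log (hh y)] at h2
      exact h2
    calc Real.exp (-(2 * a)) * m ≤ Real.exp (-(2 * a)) * (h y * Real.exp (2 * a)) := by gcongr
      _ = h y := by
        rw [mul_comm (h y), ← mul_assoc, ← Real.exp_add]
        simp
  · have := Nat.zero_le (2 * K * P)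
    rw [← hP]
    omega

/-- Iterated expansion of positivity: from a cube to a cube `2 ^ i` times larger a positive harmonic
function loses at most a factor polynomial in `2 ^ i`. -/
theorem le_of_expansion {Λ : ℕ} {c₀ : ℝ}
    (hc₀ : ∀ (h : (Fin d → ℤ) → ℝ) (x₁ : Fin d → ℤ) (j : ℕ) (m : ℝ), (∀ x, 0 < h x) → 0 < m →
        (∀ x ∈ cube x₁ (Λ * 2 ^ j), HarmonicAt C K h x) →
        1 * (2 ^ j) ^ d ≤ (((cube x₁ (2 ^ j)).filter fun z => m ≤ h z).card : ℝ) →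
        ∀ y ∈ cube x₁ (2 * 2 ^ j), c₀ * m ≤ h y)
    {β : ℕ} (hβ : (1 / 2 : ℝ) ^ β ≤ c₀) {h : (Fin d → ℤ) → ℝ} (hh : ∀ x, 0 < h x)
    (x₁ : Fin d → ℤ) (j : ℕ) {m : ℝ} (hm : 0 < m) (hj : ∀ y ∈ cube x₁ (2 ^ j), m ≤ h y) (i : ℕ)
    (hharm : ∀ x ∈ cube x₁ (Λ * 2 ^ (j + i)), HarmonicAt C K h x) :
    ∀ y ∈ cube x₁ (2 ^ (j + i)), ((1 / 2 : ℝ) ^ i) ^ β * m ≤ h y := by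
  induction i with
  | zero => simpa using hj
  | succ i ih =>
    have hle : Λ * 2 ^ (j + i) ≤ Λ * 2 ^ (j + (i + 1)) :=
      Nat.mul_le_mul_left _ (Nat.pow_le_pow_right (by norm_num) (by omega))
    have hharm' := fun x hx => hharm x (cube_mono x₁ hle hx)
    have h1 := ih hharm'
    intro y hy
    have h2 := hc₀ h x₁ (j + i) (((1 / 2 : ℝ) ^ i) ^ β * m) hh (by positivity) hharm' (by
      rw [Finset.filter_true_of_mem h1, card_cube, one_mul]
      push_cast
      have : (0 : ℝ) < 2 ^ (j + i) := by positivity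
      gcongr
      linarith) y (by rwa [← pow_succ'])
    refine le_trans ?_ h2
    calc ((1 / 2 : ℝ) ^ (i + 1)) ^ β * m = (1 / 2) ^ β * (((1 / 2 : ℝ) ^ i) ^ β * m) := by
          rw [pow_succ, mul_pow]
          ring
      _ ≤ _ := by gcongr

/-- **Harnack inequality on cubes** for positive harmonic functions. The weighted function
`(2R - |x - x₀|) ^ β * h x` is maximised at a point `x₁`. Near `x₁` the function `h` is at most a
constant times `h x₁`, so the local maximum principle makes `h ≥ h x₁ / 2` on a fixed proportion of
a cube around `x₁`. Expansion of positivity carries this bound to the whole cube, and the exponent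
`β` is chosen to absorb the factor lost on the way. -/
theorem exists_harnack_cube (hN : IsNetwork C K M c₂ κ) :
    ∃ (Λ : ℕ) (c : ℝ), 0 < c ∧ ∀ (h : (Fin d → ℤ) → ℝ) (x₀ : Fin d → ℤ) (J : ℕ),
      (∀ x, 0 < h x) → (∀ x ∈ cube x₀ (Λ * 2 ^ J), HarmonicAt C K h x) →
      ∀ x ∈ cube x₀ (2 ^ J), ∀ y ∈ cube x₀ (2 ^ J), h x ≤ c * h y := by
  obtain ⟨τ, hτ⟩ := hN.exists_localMax
  obtain ⟨Λ, hΛ⟩ := hN.exists_expansion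
  obtain ⟨c₀, hc₀, hexp₀⟩ := hΛ 1 one_pos
  obtain ⟨β', hβ'⟩ := exists_pow_lt_of_lt_one hc₀ (by norm_num : (1 / 2 : ℝ) < 1)
  -- A positive exponent makes the weight vanish on the boundary of the large cube.
  set β := β' + 1 with hβdef
  have hβ : (1 / 2 : ℝ) ^ β ≤ c₀ :=
    (pow_le_pow_of_le_one (by norm_num) (by norm_num) (Nat.le_succ β')).trans hβ'.le
  set ε : ℝ := 1 / (128 * (2 ^ β) ^ 2 * (2 ^ (τ + 1)) ^ d) with hε
  have hε0 : 0 < ε := by positivity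
  obtain ⟨c₁, hc₁, hexp₁⟩ := hΛ ε hε0
  set T : ℝ := 2 ^ τ with hT
  have hT1 : 1 ≤ T := one_le_pow₀ (by norm_num)
  set c' := min c₀ (c₁ / 2) with hc'
  have hc'0 : 0 < c' := lt_min hc₀ (by linarith)
  refine ⟨2 + 4 * Λ, (16 * T) ^ β / c', by positivity, fun h x₀ J hh hharm x hx y hy => ?_⟩
  set R : ℝ := 2 ^ J with hR
  have hR0 : 0 < R := by positivity
  set s : (Fin d → ℤ) → ℝ := fun z => 2 * R - dist z x₀ with hs
  have hs0 : ∀ z ∈ cube x₀ (2 * 2 ^ J), 0 ≤ s z := by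
    intro z hz
    have := mem_cube.1 hz
    push_cast at this
    simp only [hs]
    linarith
  obtain ⟨x₁, hx₁, hmax⟩ := Finset.exists_max_image (cube x₀ (2 * 2 ^ J))
    (fun z => s z ^ β * h z) ⟨x₀, self_mem_cube _ _⟩
  have hx₁d : dist x₁ x₀ ≤ 2 * R := by
    have := mem_cube.1 hx₁
    push_cast at this
    linarith
  have hs1 : 0 < s x₁ := by
    refine lt_of_le_of_ne (hs0 x₁ hx₁) fun h0 => ?_
    have h1 := hmax x₀ (self_mem_cube _ _)
    rw [← h0, zero_pow (by omega), zero_mul] at h1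
    have h2 : 0 < s x₀ ^ β * h x₀ := by
      have : s x₀ = 2 * R := by simp [hs]
      rw [this]
      have := hh x₀
      positivity
    linarith
  have hh1 := hh x₁
  have hharm1 : ∀ j : ℕ, (2 : ℝ) ^ j ≤ 4 * R → ∀ z ∈ cube x₁ (Λ * 2 ^ j), HarmonicAt C K h z := by
    intro j hj z hz
    refine hharm z (cube_subset_cube ?_ hz)
    push_cast
    have : (Λ : ℝ) * 2 ^ j ≤ Λ * (4 * R) := by gcongr
    nlinarith
  obtain ⟨j, hjR, hsj, hlow⟩ : ∃ j : ℕ, (2 : ℝ) ^ j ≤ R ∧ s x₁ ≤ 4 * T * 2 ^ j ∧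
      ∀ z ∈ cube x₁ (2 ^ j), c' * h x₁ ≤ h z := by
    rcases lt_or_ge (s x₁) (4 * T) with hsmall | hlarge
    · -- Close to the boundary of the large cube the single point `x₁` fills a proportion of the
      -- unit cube.
      have hR1 : 1 ≤ R := one_le_pow₀ (by norm_num)
      refine ⟨0, by simpa using hR1, by simpa using hsmall.le, fun z hz => ?_⟩
      have h1 := hexp₀ h x₁ 0 (h x₁) hh hh1 (hharm1 0 (by simp; linarith)) (by
        have : 0 < ((cube x₁ (2 ^ 0)).filter fun z => h x₁ ≤ h z).card :=
          Finset.card_pos.2 ⟨x₁, Finset.mem_filter.2 ⟨self_mem_cube _ _, le_rfl⟩⟩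
        simp only [pow_zero, one_pow, mul_one]
        exact_mod_cast this) z (cube_mono x₁ (by norm_num) hz)
      refine le_trans ?_ h1
      gcongr
      exact min_le_left _ _
    · obtain ⟨j, hj1, hj2⟩ := exists_nat_pow_near (x := s x₁ / (4 * T)) (y := 2)
        (by rw [le_div_iff₀ (by positivity)]; linarith) (by norm_num)
      rw [le_div_iff₀ (by positivity)] at hj1
      rw [div_lt_iff₀ (by positivity)] at hj2
      have hs1R : s x₁ ≤ 2 * R := by
        simp only [hs]
        linarith [dist_nonneg (x := x₁) (y := x₀)]
      have hpow : (2 : ℝ) ^ (j + τ + 1) = 2 * T * 2 ^ j := by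
        rw [pow_succ, pow_add]
        ring
      have hcubeEq : 2 * 2 ^ τ * 2 ^ j = 2 ^ (j + τ + 1) := by
        rw [pow_succ, pow_add]
        ring
      have hjR : (2 : ℝ) ^ (j + τ + 1) ≤ R := by
        rw [hpow]
        linarith
      have hsub : ∀ z ∈ cube x₁ (2 ^ (j + τ + 1)), s x₁ / 2 ≤ s z ∧ z ∈ cube x₀ (2 * 2 ^ J) := by
        intro z hz
        have h1 := mem_cube.1 hz
        push_cast at h1
        rw [hpow] at h1
        have h2 := dist_triangle z x₁ x₀
        have h3 : s x₁ / 2 ≤ s z := by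
          have h4 : s z = 2 * R - dist z x₀ := rfl
          have h5 : s x₁ = 2 * R - dist x₁ x₀ := rfl
          linarith
        refine ⟨h3, mem_cube.2 ?_⟩
        push_cast
        have h4 : s z = 2 * R - dist z x₀ := rfl
        linarith
      have hupper : ∀ z ∈ cube x₁ (2 ^ (j + τ + 1)), h z ≤ 2 ^ β * h x₁ := by
        intro z hz
        obtain ⟨h1, h2⟩ := hsub z hz
        have h3 := hmax z h2
        have h4 : (s x₁ / 2) ^ β * h z ≤ s x₁ ^ β * h x₁ := by
          refine le_trans ?_ h3
          have := (hh z).le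
          gcongr
        have h5 : s x₁ ^ β * h z ≤ s x₁ ^ β * (2 ^ β * h x₁) := by
          rw [div_pow, div_mul_eq_mul_div, div_le_iff₀ (by positivity)] at h4
          linarith
        exact le_of_mul_le_mul_left h5 (by positivity)
      set Z := (cube x₁ (2 ^ (j + τ + 1))).filter fun z => h x₁ / 2 ≤ h z with hZ
      have hcard : ε * (2 ^ (j + τ + 1)) ^ d ≤ Z.card := by
        have hlt : (h x₁ / 8) ^ 2 / 2 * (2 ^ j) ^ d
            < ∑ z ∈ cube x₁ (2 ^ (j + τ + 1)), max (h z - h x₁ / 2) 0 ^ 2 := by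
          by_contra! hcon
          rw [← hcubeEq, ← zero_add (2 * 2 ^ τ * 2 ^ j)] at hcon
          have := hτ h x₁ j 0 (h x₁ / 2) (h x₁ / 8) (by positivity) (fun z hz => by
            rw [zero_add, hcubeEq] at hz
            refine (hharm z (cube_mono x₀ ?_ (hsub z hz).2)).le
            exact Nat.mul_le_mul_right _ (by omega)) hcon x₁ (self_mem_cube _ _)
          linarith
        have hle : ∑ z ∈ cube x₁ (2 ^ (j + τ + 1)), max (h z - h x₁ / 2) 0 ^ 2
            ≤ Z.card * (2 ^ β * h x₁) ^ 2 := by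
          rw [← nsmul_eq_mul, ← Finset.sum_const, hZ, Finset.sum_filter]
          refine Finset.sum_le_sum fun z hz => ?_
          split_ifs with hz'
          · have h1 : max (h z - h x₁ / 2) 0 ≤ 2 ^ β * h x₁ :=
              max_le (by linarith [hupper z hz]) (by positivity)
            have h2 : 0 ≤ max (h z - h x₁ / 2) 0 := le_max_right _ _
            gcongr
          · rw [max_eq_right (by linarith)]
            simp
        have h1 : h x₁ ^ 2 * ((2 ^ j) ^ d) ≤ h x₁ ^ 2 * (128 * (2 ^ β) ^ 2 * Z.card) := by
          nlinarith
        have h2 := le_of_mul_le_mul_left h1 (by positivity)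
        have h3 : ((2 : ℝ) ^ (j + τ + 1)) ^ d = (2 ^ j) ^ d * (2 ^ (τ + 1)) ^ d := by
          rw [← mul_pow, ← pow_add, add_assoc]
        rw [hε, h3, one_div, inv_mul_le_iff₀ (by positivity)]
        calc ((2 : ℝ) ^ j) ^ d * (2 ^ (τ + 1)) ^ d
            ≤ (128 * (2 ^ β) ^ 2 * Z.card) * (2 ^ (τ + 1)) ^ d := by gcongr
          _ = _ := by ring
      refine ⟨j + τ + 1, hjR, ?_, fun z hz => ?_⟩
      · rw [hpow]
        rw [pow_succ] at hj2
        have : 0 < (2 : ℝ) ^ j := by positivity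
        nlinarith [mul_pos (by linarith : 0 < T) this]
      · have h1 := hexp₁ h x₁ (j + τ + 1) (h x₁ / 2) hh (by positivity)
          (hharm1 _ (by linarith)) hcard z (cube_mono x₁ (by omega) hz)
        refine le_trans ?_ h1
        have : c' ≤ c₁ / 2 := min_le_right _ _
        nlinarith
  have hjJ : j ≤ J := (pow_le_pow_iff_right₀ (by norm_num : (1 : ℝ) < 2)).1 hjR
  have hpowJ : (2 : ℝ) ^ (j + (J + 2 - j)) = 4 * R := by
    rw [show j + (J + 2 - j) = J + 2 by omega, pow_add]
    ring
  have hy1 : h y ≥ ((1 / 2 : ℝ) ^ (J + 2 - j)) ^ β * (c' * h x₁) := by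
    refine le_of_expansion hexp₀ hβ hh x₁ j (by positivity) hlow (J + 2 - j)
      (hharm1 _ hpowJ.le) y (cube_subset_cube (x := x₀) (m := 2 ^ J) ?_ hy)
    push_cast
    rw [hpowJ, dist_comm]
    linarith
  have hhalf : s x₁ / (16 * T * R) ≤ (1 / 2 : ℝ) ^ (J + 2 - j) := by
    have h1 : (2 : ℝ) ^ j = 4 * R * (1 / 2) ^ (J + 2 - j) := by
      rw [← hpowJ, pow_add, mul_assoc, ← mul_pow]
      norm_num
    rw [div_le_iff₀ (by positivity)]
    rw [h1] at hsj
    linarith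
  have hxs : R ^ β * h x ≤ s x₁ ^ β * h x₁ := by
    refine le_trans ?_ (hmax x (cube_mono x₀ (by omega) hx))
    have h1 : R ≤ s x := by
      have := mem_cube.1 hx
      push_cast at this
      simp only [hs]
      linarith
    have := (hh x).le
    gcongr
  have hfin : c' / (16 * T) ^ β * h x ≤ h y := by
    calc c' / (16 * T) ^ β * h x = c' / (16 * T * R) ^ β * (R ^ β * h x) := by
          rw [mul_pow _ R]
          field_simp
      _ ≤ c' / (16 * T * R) ^ β * (s x₁ ^ β * h x₁) := by gcongr
      _ = (s x₁ / (16 * T * R)) ^ β * (c' * h x₁) := by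
          rw [div_pow]
          ring
      _ ≤ ((1 / 2 : ℝ) ^ (J + 2 - j)) ^ β * (c' * h x₁) := by gcongr
      _ ≤ h y := hy1
  rw [div_mul_eq_mul_div, div_le_iff₀ (by positivity)] at hfin
  rw [div_mul_eq_mul_div, le_div_iff₀ hc'0]
  linarith

end IsNetwork

/-! ### From the Euclidean hypotheses to finite-range networks -/

theorem abs_sub_le_eDist (x y : Fin d → ℤ) (i : Fin d) : (|y i - x i| : ℤ) ≤ eDist x y := by
  have h := PiLp.norm_apply_le (p := 2) (latticePoint x - latticePoint y) i
  refine le_trans (le_of_eq ?_) h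
  simp [latticePoint, abs_sub_comm]

theorem mem_cube_of_eDist_le {x y : Fin d → ℤ} {n : ℕ} (h : eDist x y ≤ n) : y ∈ cube x n := by
  rw [mem_cube_iff_abs]
  intro i
  exact_mod_cast (abs_sub_le_eDist x y i).trans h

theorem eDist_le_of_mem_cube {x y : Fin d → ℤ} {n : ℕ} (h : y ∈ cube x n) :
    eDist x y ≤ d * n := by
  rw [mem_cube_iff_abs] at h
  rw [eDist, EuclideanSpace.norm_eq]
  refine Real.sqrt_le_iff.2 ⟨by positivity, ?_⟩
  have h1 : ∀ i, ‖(latticePoint x - latticePoint y) i‖ ^ 2 ≤ (n : ℝ) ^ 2 := by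
    intro i
    have h2 : ‖(latticePoint x - latticePoint y) i‖ ≤ n := by
      have h3 : ((|y i - x i| : ℤ) : ℝ) ≤ n := by exact_mod_cast h i
      simpa [latticePoint, abs_sub_comm] using h3
    gcongr
  calc _ ≤ ∑ _i : Fin d, (n : ℝ) ^ 2 := Finset.sum_le_sum fun i _ => h1 i
    _ = d * (n : ℝ) ^ 2 := by simp
    _ ≤ (d * n : ℝ) ^ 2 := by
      rw [mul_pow]
      refine mul_le_mul_of_nonneg_right ?_ (sq_nonneg _)
      exact_mod_cast Nat.le_self_pow two_ne_zero d

theorem one_le_eDist {x y : Fin d → ℤ} (h : x ≠ y) : 1 ≤ eDist x y := by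
  obtain ⟨i, hi⟩ := Function.ne_iff.1 h
  refine le_trans ?_ (abs_sub_le_eDist x y i)
  exact_mod_cast Int.one_le_abs (sub_ne_zero.2 (Ne.symm hi))

theorem eDist_add_single (x : Fin d → ℤ) (i : Fin d) : eDist x (x + Pi.single i 1) = 1 := by
  have : latticePoint x - latticePoint (x + Pi.single i 1) = - EuclideanSpace.single i (1 : ℝ) := by
    ext k
    rcases eq_or_ne k i with rfl | hk <;> simp [latticePoint, *]
  rw [eDist, this, norm_neg]
  simp

/-- A function whose increments along the steps of a chain inside a finite set are at most `D`
changes by at most the size of the set times `D` along the chain, however long the chain is: a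
path without repetitions joins the same endpoints. -/
theorem abs_sub_le_of_chain {α : Type*} (A : Finset α) (r : α → α → Prop)
    (hr : ∀ u v, r u v → r v u) (f : α → ℝ) {D : ℝ} (hD : 0 ≤ D)
    (hf : ∀ u ∈ A, ∀ v ∈ A, r u v → |f u - f v| ≤ D) (N : ℕ) (hN : 1 ≤ N) (z : ℕ → α)
    (hz : ∀ i, 1 ≤ i → i ≤ N → z i ∈ A) (hstep : ∀ i, 1 ≤ i → i < N → r (z i) (z (i + 1))) :
    |f (z 1) - f (z N)| ≤ A.card * D := by
  classical
  let G : SimpleGraph A :=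
    { Adj := fun u v => u ≠ v ∧ r u v
      symm := ⟨fun u v h => ⟨h.1.symm, hr _ _ h.2⟩⟩
      loopless := ⟨fun u h => h.1 rfl⟩ }
  have hwalk : ∀ (u v : A) (p : G.Walk u v), |f u - f v| ≤ p.length * D := by
    intro u v p
    induction p with
    | nil => simp
    | @cons u v w huv p ih =>
      rw [SimpleGraph.Walk.length_cons]
      push_cast
      linarith [abs_sub_le (f u) (f v) (f w), hf u u.2 v v.2 huv.2]
  have hreach : ∀ i (h1 : 1 ≤ i) (h2 : i ≤ N),
      G.Reachable ⟨z 1, hz 1 le_rfl hN⟩ ⟨z i, hz i h1 h2⟩ := by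
    intro i h1
    induction i, h1 using Nat.le_induction with
    | base => exact fun _ => SimpleGraph.Reachable.refl _
    | succ i h1 ih =>
      intro h2
      refine (ih (by omega)).trans ?_
      by_cases heq : z i = z (i + 1)
      · simp only [heq]
        exact SimpleGraph.Reachable.refl _
      · exact SimpleGraph.Adj.reachable ⟨fun h => heq (congrArg Subtype.val h), hstep i h1 h2⟩
  obtain ⟨p, hp⟩ := (hreach N hN le_rfl).exists_isPath
  refine (hwalk _ _ p).trans ?_
  have h1 : p.length < Fintype.card A := hp.length_lt
  rw [Fintype.card_coe] at h1
  have h2 : (p.length : ℝ) ≤ A.card := by exact_mod_cast h1.le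
  gcongr

/-- Uniform local irreducibility bounds a nearest-neighbour increment by the energy in a cube of
fixed radius. -/
theorem UniformlyLocallyIrreducible.exists_sq_sub_le {C : (Fin d → ℤ) → (Fin d → ℤ) → ℝ}
    (hA2 : UniformlyLocallyIrreducible C) (hC : IsConductance C) :
    ∃ (M : ℕ) (κ : ℝ), 0 < κ ∧ ∀ (f : (Fin d → ℤ) → ℝ) (x : Fin d → ℤ) (i : Fin d),
      (f (x + Pi.single i 1) - f x) ^ 2 ≤ κ * energy C (cube x M) f := by
  obtain ⟨M₀, δ, -, hδ, hpath⟩ := hA2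
  set M := ⌈M₀⌉₊ with hM
  refine ⟨M, ((2 * M + 1) ^ d) ^ 2 / δ, by positivity, fun f x i => ?_⟩
  obtain ⟨N, hN, z, hz, hz1, hzN, hstep⟩ := hpath x _ (eDist_add_single x i)
  have hpos : ∀ u v, 0 ≤ C u v * (f u - f v) ^ 2 := fun u v =>
    mul_nonneg (hC.nonneg u v) (sq_nonneg _)
  set E := energy C (cube x M) f with hE
  have hE0 : 0 ≤ E := Finset.sum_nonneg fun u _ => Finset.sum_nonneg fun v _ => hpos u v
  have hinc : ∀ u ∈ cube x M, ∀ v ∈ cube x M, δ ≤ C u v → |f u - f v| ≤ √(E / δ) := by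
    intro u hu v hv huv
    refine Real.abs_le_sqrt ?_
    rw [le_div_iff₀ hδ]
    calc (f u - f v) ^ 2 * δ ≤ C u v * (f u - f v) ^ 2 := by
          rw [mul_comm]
          gcongr
      _ ≤ ∑ v ∈ cube x M, C u v * (f u - f v) ^ 2 :=
          Finset.single_le_sum (f := fun v => C u v * (f u - f v) ^ 2) (fun v _ => hpos u v) hv
      _ ≤ E := Finset.single_le_sum (f := fun u => ∑ v ∈ cube x M, C u v * (f u - f v) ^ 2)
          (fun u _ => Finset.sum_nonneg fun v _ => hpos u v) hu
  have h1 := abs_sub_le_of_chain (cube x M) (fun u v => δ ≤ C u v)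
    (fun u v h => by rwa [hC.symm v u]) f (Real.sqrt_nonneg _) hinc N (by omega) z
    (fun k hk1 hk2 => mem_cube_of_eDist_le ((hz k hk1 hk2).le.trans (Nat.le_ceil M₀))) hstep
  rw [hz1, hzN, card_cube] at h1
  calc (f (x + Pi.single i 1) - f x) ^ 2 = |f x - f (x + Pi.single i 1)| ^ 2 := by
        rw [sq_abs]
        ring
    _ ≤ (((2 * M + 1) ^ d : ℕ) * √(E / δ)) ^ 2 := by gcongr
    _ = ((2 * M + 1) ^ d) ^ 2 / δ * E := by
        rw [mul_pow, Real.sq_sqrt (by positivity)]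
        push_cast
        ring

section FiniteRange

variable {C : (Fin d → ℤ) → (Fin d → ℤ) → ℝ} {c₁ K : ℝ}

theorem eDist_le_of_ne_zero (hc₁ : 0 < c₁) (hν : ∀ x, c₁ ≤ totalConductance C x)
    (hK : RangeBoundedBy C K) {x y : Fin d → ℤ} (hxy : C x y ≠ 0) : eDist x y ≤ K := by
  by_contra! h
  rcases div_eq_zero_iff.1 (hK x y h) with h0 | h0
  · exact hxy h0
  · linarith [hν x]

theorem one_le_range (hC : IsConductance C) (hc₁ : 0 < c₁)
    (hν : ∀ x, c₁ ≤ totalConductance C x) (hK : RangeBoundedBy C K) : 1 ≤ K := by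
  obtain ⟨y, hy⟩ : ∃ y, C 0 y ≠ 0 := by
    by_contra! h
    have h1 := hν 0
    rw [totalConductance, tsum_congr h, tsum_zero] at h1
    linarith
  have h0 : (0 : Fin d → ℤ) ≠ y := by
    rintro rfl
    exact hy (hC.diag 0)
  exact (one_le_eDist h0).trans (eDist_le_of_ne_zero hc₁ hν hK hy)

theorem mem_cube_ceil_of_ne_zero (hc₁ : 0 < c₁) (hν : ∀ x, c₁ ≤ totalConductance C x)
    (hK : RangeBoundedBy C K) (x y : Fin d → ℤ) (hxy : C x y ≠ 0) : y ∈ cube x ⌈K⌉₊ :=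
  mem_cube_of_eDist_le ((eDist_le_of_ne_zero hc₁ hν hK hxy).trans (Nat.le_ceil K))

theorem totalConductance_eq_sum (hc₁ : 0 < c₁) (hν : ∀ x, c₁ ≤ totalConductance C x)
    (hK : RangeBoundedBy C K) (x : Fin d → ℤ) :
    totalConductance C x = ∑ y ∈ cube x ⌈K⌉₊, C x y :=
  tsum_eq_sum fun y hy => by_contra fun h => hy (mem_cube_ceil_of_ne_zero hc₁ hν hK x y h)

/-- For a chain of bounded range the mean value property is a finite linear equation. -/
theorem HarmonicOnSet.harmonicAt {h : (Fin d → ℤ) → ℝ} {A : Set (Fin d → ℤ)}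
    (hA : HarmonicOnSet C h A) (hc₁ : 0 < c₁) (hν : ∀ x, c₁ ≤ totalConductance C x)
    (hK : RangeBoundedBy C K) {x : Fin d → ℤ} (hx : x ∈ A) : HarmonicAt C ⌈K⌉₊ h x := by
  have hν0 : totalConductance C x ≠ 0 := by linarith [hν x]
  have h1 : h x = ∑ z ∈ cube x ⌈K⌉₊, h z * stepProb C x z := by
    refine (hA x hx).unique (hasSum_sum_of_ne_finset_zero fun z hz => ?_)
    rw [stepProb, by_contra fun h => hz (mem_cube_ceil_of_ne_zero hc₁ hν hK x z h), zero_div,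
      mul_zero]
  have h2 : totalConductance C x * h x = ∑ z ∈ cube x ⌈K⌉₊, C x z * h z := by
    rw [h1, Finset.mul_sum]
    refine Finset.sum_congr rfl fun z _ => ?_
    rw [stepProb]
    field_simp
  rw [HarmonicAt]
  simp only [mul_sub, Finset.sum_sub_distrib]
  rw [← h2, ← Finset.sum_mul, ← totalConductance_eq_sum hc₁ hν hK, sub_self]

end FiniteRange

end ConductanceChain

theorem theorem5p1 (d : ℕ) (hd : 1 ≤ d) (C : (Fin d → ℤ) → (Fin d → ℤ) → ℝ)
    (hC : ConductanceChain.IsConductance C)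
    (hA1 : ConductanceChain.BoundedTotalConductance C)
    (hA2 : ConductanceChain.UniformlyLocallyIrreducible C)
    (hA3 : ConductanceChain.UniformSecondMoment C)
    (K : ℝ) (hK : ConductanceChain.RangeBoundedBy C K) :
    ∃ c θ : ℝ, 0 < c ∧ 0 < θ ∧ θ < 1 ∧
      ∀ (x₀ : Fin d → ℤ) (r : ℝ), 4 * K * (θ⁻¹ + 1) ≤ r →
        ∀ h : (Fin d → ℤ) → ℝ, (∀ z, 0 ≤ h z) → (∃ M : ℝ, ∀ z, h z ≤ M) →
          ConductanceChain.HarmonicOnSet C h (ConductanceChain.latticeBall x₀ r) →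
          ∀ x ∈ ConductanceChain.latticeBall x₀ (θ * r),
            ∀ y ∈ ConductanceChain.latticeBall x₀ (θ * r), h x ≤ c * h y := by
  open ConductanceChain in
  obtain ⟨c₁, c₂, hc₁, hc₂, hbound⟩ := hA1
  have hν : ∀ x, c₁ ≤ totalConductance C x := fun x => (hbound x).2.1
  have hK1 : 1 ≤ K := one_le_range hC hc₁ hν hK
  obtain ⟨M, κ, hκ, hstep⟩ := hA2.exists_sq_sub_le hC
  have hN : IsNetwork C ⌈K⌉₊ M c₂ κ :=
    { nonneg := hC.nonneg
      symm := hC.symm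
      range := mem_cube_ceil_of_ne_zero hc₁ hν hK
      total_le := fun x => by
        rw [← totalConductance_eq_sum hc₁ hν hK]
        exact (hbound x).2.2
      step := hstep
      range_pos := Nat.one_le_ceil_iff.2 (by linarith)
      total_pos := hc₂
      step_pos := hκ }
  obtain ⟨Λ, c, hc, hH⟩ := hN.exists_harnack_cube
  -- The dyadic cube used below has radius at most `2 * θ * r`, and `Λ` times that cube lies in the
  -- Euclidean ball of radius `2 * d * Λ * θ * r < r`.
  set θ : ℝ := 1 / (2 * d * Λ + 2) with hθ
  have hθ0 : 0 < θ := by positivity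
  have hθ1 : θ < 1 := by
    rw [hθ, div_lt_one (by positivity)]
    have : (0 : ℝ) ≤ 2 * d * Λ := by positivity
    linarith
  refine ⟨c, θ, hc, hθ0, hθ1, fun x₀ r hr h hh0 _ hharm x hx y hy => ?_⟩
  have hinv : 0 < θ⁻¹ := inv_pos.2 hθ0
  have hr0 : 0 < r := by nlinarith
  have hθr : 1 ≤ θ * r := by
    have h1 : θ⁻¹ ≤ r := by nlinarith
    calc 1 = θ * θ⁻¹ := (mul_inv_cancel₀ hθ0.ne').symm
      _ ≤ θ * r := by gcongr
  obtain ⟨J, hJ1, hJ2⟩ := exists_nat_pow_near hθr (by norm_num : (1 : ℝ) < 2)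
  have hball : ∀ z ∈ latticeBall x₀ (θ * r), z ∈ cube x₀ (2 ^ (J + 1)) := by
    intro z hz
    refine mem_cube_of_eDist_le (le_trans (le_of_lt hz) ?_)
    push_cast
    exact hJ2.le
  have hcube : ∀ z ∈ cube x₀ (Λ * 2 ^ (J + 1)), z ∈ latticeBall x₀ r := by
    intro z hz
    refine lt_of_le_of_lt (eDist_le_of_mem_cube hz) ?_
    push_cast
    calc (d : ℝ) * (Λ * 2 ^ (J + 1)) = 2 * d * Λ * 2 ^ J := by ring
      _ ≤ 2 * d * Λ * (θ * r) := by gcongr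
      _ < (2 * d * Λ + 2) * (θ * r) := by nlinarith
      _ = r := by
        rw [hθ]
        field_simp
  -- Adding a constant makes `h` positive and keeps it harmonic.
  have hε : ∀ ε : ℝ, 0 < ε → h x + ε ≤ c * (h y + ε) := by
    intro ε hε
    refine hH (fun z => h z + ε) x₀ (J + 1) (fun z => by linarith [hh0 z]) (fun z hz => ?_)
      x (hball x hx) y (hball y hy)
    have h1 := hharm.harmonicAt hc₁ hν hK (hcube z hz)
    simpa [HarmonicAt] using h1
  refine le_of_forall_pos_le_add fun ε hε0 => ?_
  have h1 := hε (ε / c) (by positivity)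
  have h2 : 0 < ε / c := by positivity
  have h3 : c * (ε / c) = ε := by field_simp
  linarith
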